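/- Let $p,q,n\ge 1$. Consider the problem $$\min\ \sum_{i=1}^p f_i(x_i)+\sum_{j=1}^q g_j(y_j)\quad\text{s.t.}\quad \sum_{i=1}^p A_ix_i+\sum_{j=1}^q B_jy_j=c,\quad x_i\in\mathcal X_i,\ y_j\in\mathcal Y_j,$$ where $f_i:\mathbb R^{m_i}\to\mathbb R$ and $g_j:\mathbb R^{d_j}\to\mathbb R$ are convex, all subdifferentials $\partial f_i,\partial g_j$ are piecewise linear multifunctions (their graphs are finite unions of polyhedra), $\mathcal X_i,\mathcal Y_j$ are polyhedra, $A_i\in\mathbb R^{n\times m_i}$ and $B_j\in\mathbb R^{n\times d_j}$ have full column rank, $c\in\mathbb R^n$, and a minimizer exists. Write $w=(x,y,\lambda)$, $\mathcal A x=\sum_i A_ix_i$, $\mathcal B y=\sum_j B_jy_j$, $\mathcal B=[B_1,\dots,B_q]$, $h(x,y)=\sum_i f_i(x_i)+\sum_j g_j(y_j)$, $\mathcal M=\prod_i\mathcal X_i\times\prod_j\mathcal Y_j\times\mathbb R^n$, $\mathcal J(w)=(-\mathcal A^{\sf T}\lambda,-\mathcal B^{\sf T}\lambda,\mathcal Ax+\mathcal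 By-c)$ and $$\mathcal M^*=\{\hat w\in\mathcal M:\ h(x,y)-h(\hat x,\hat y)+\langle w-\hat w,\mathcal J(w)\rangle\ge 0\ \ \forall w\in\mathcal M\}.$$ Let $\beta>0$, $\sigma_1>p-1$, $\sigma_2>q-1$, $\tau<1$, $s<1$, $\tau+s>0$, and let $\mathcal L_\beta(x,y,\lambda)=h(x,y)-\langle\lambda,\mathcal Ax+\mathcal By-c\rangle+\frac\beta2\|\mathcal Ax+\mathcal By-c\|^2$. A sequence $w^k=(x^k,y^k,\lambda^k)$, $k\ge0$, with arbitrary $w^0$, is generated by GS-ADMM if for all $k$ $$\begin{aligned} x_i^{k+1}&=\arg\min_{x_i\in\mathcal X_i}\ \mathcal L_\beta(x_1^k,\dots,x_i,\dots,x_p^k,y^k,\lambda^k)+\tfrac{\sigma_1\beta}2\|A_i(x_i-x_i^k)\|^2,\quad i=1,\dots,p,\\ \lambda^{k+1/2}&=\lambda^k-\tau\beta(\mathcal Ax^{k+1}+\mathcal By^k-c),\\ y_j^{k+1}&=\arg\min_{y_j\in\mathcal Y_j}\ \mathcal L_\beta(x^{k+1},y_1^k,\dots,y_j,\dots,y_q^k,\lambda^{k+1/2})+\tfrac{\sigma_2\beta}2\|B_j(y_j-y_j^k)\|^2,\quad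 j=1,\dots,q,\\ \lambda^{k+1}&=\lambda^{k+1/2}-s\beta(\mathcal Ax^{k+1}+\mathcal By^{k+1}-c). \end{aligned}$$ Let $$Q=\begin{pmatrix}H_x&0&0\\0&D_y&-\tau\mathcal B^{\sf T}\\0&-\mathcal B&\frac1\beta I\end{pmatrix},\quad M=\begin{pmatrix}I&0&0\\0&I&0\\0&-s\beta\mathcal B&(\tau+s)I\end{pmatrix},\quad G=Q+Q^{\sf T}-M^{\sf T}Q,\quad H=QM^{-1},$$ where $H_x$ has diagonal blocks $\sigma_1\beta A_i^{\sf T}A_i$ and off-diagonal blocks $-\beta A_i^{\sf T}A_l$, and $D_y$ is block diagonal with blocks $(\sigma_2+1)\beta B_j^{\sf T}B_j$. Put $\|v\|_H=\sqrt{v^{\sf T}Hv}$ and $\mathrm{dist}_H(w,\mathcal M^*)=\inf_{w^*\in\mathcal M^*}\|w-w^*\|_H$. Let $\mu_i=\lambda_{\max}(A_i^{\sf T}A_i)$, $\nu_j=\lambda_{\max}(B_j^{\sf T}B_j)$, $$\begin{aligned} \bar\theta_i&=4p(1-\sigma_1)^2\beta^2\textstyle\sum_l\mu_l+4\beta^2\mu_i,\\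 \bar\vartheta_j&=4q(s\beta)^2\textstyle\sum_l\mu_l+3q(s\beta)^2\sum_l\nu_l+3(\sigma_2+1)^2\beta^2\nu_j+2q,\\ \bar\eta&=4(\tau+s-1)^2\textstyle\sum_l\mu_l+3(s-1)^2\sum_l\nu_l+\frac2{\beta^2}, \end{aligned}$$ $\delta=\max_{i,j}\{\bar\theta_i,\bar\vartheta_j,\bar\eta\}$ and, for $\zeta>0$, $$\epsilon=\epsilon(\zeta)=\frac{\lambda_{\min}(G)}{\zeta^2\max_{i,j}\{\delta\mu_i,\delta\nu_j,\delta\}\lambda_{\max}(H)},\qquad r=\frac1{\sqrt{1+\epsilon}},\qquad C=\frac{2\,\mathrm{dist}_H(w^0,\mathcal M^*)}{1-r}.$$ Then $H$ is symmetric positive definite; for every $\zeta>0$ one has $\epsilon>0$ and $r\in(0,1)$, and $C>0$ whenever $w^0\notin\mathcal M^*$. For every $R$ there is a constant $\zeta>0$ such that every GS-ADMM sequence with $\mathrm{dist}_H(w^0,\mathcal M^*)\le R$ satisfies, with $\epsilon=\epsilon(\zeta)$, $$\mathrm{dist}_H^2(w^{k+1},\mathcal M^*)\le\frac1{1+\epsilon}\,\mathrm{dist}_H^2(w^k,\mathcal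 M^*)\qquad\text{for all }k\ge 0.\tag{1}$$ Moreover, for every $\zeta>0$ and every GS-ADMM sequence satisfying (1), in particular for every GS-ADMM sequence and a $\zeta$ as just described, there is a point $w^\infty\in\mathcal M^*$ such that $w^k\to w^\infty$ R-linearly: $$\|w^k-w^\infty\|_H\le C\,r^k\qquad\text{for all }k\ge0.$$ -/

import Mathlib

open Set Filter Topology Matrix

noncomputable section

namespace GSADMM

/-- A polyhedron: the solution set of finitely many (possibly zero) linear inequalities. -/
def IsPolyhedron {V : Type*} [AddCommGroup V] [Module ℝ V] (K : Set V) : Prop :=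
  ∃ (N : ℕ) (a : Fin N → (V →ₗ[ℝ] ℝ)) (b : Fin N → ℝ), K = {v | ∀ t, a t v ≤ b t}

/-- A multifunction is piecewise linear if its graph is a union of finitely many polyhedra. -/
def IsPiecewiseLinear {V W : Type*} [AddCommGroup V] [Module ℝ V] [AddCommGroup W] [Module ℝ W]
    (φ : V → Set W) : Prop :=
  ∃ (N : ℕ) (P : Fin N → Set (V × W)), (∀ t, IsPolyhedron (P t)) ∧
    {z : V × W | z.2 ∈ φ z.1} = ⋃ t, P t

/-- The subdifferential of a real-valued function on `ℝᵐ`. -/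
def subdifferential {m : ℕ} (f : (Fin m → ℝ) → ℝ) (x : Fin m → ℝ) : Set (Fin m → ℝ) :=
  {e | ∀ v, f x + e ⬝ᵥ (v - x) ≤ f v}

/-- The squared Euclidean norm. -/
def sqNorm {n : ℕ} (v : Fin n → ℝ) : ℝ := v ⬝ᵥ v

/-- The largest real eigenvalue of a square matrix. -/
def lamMax {ι : Type*} [Fintype ι] [DecidableEq ι] (N : Matrix ι ι ℝ) : ℝ := sSup (spectrum ℝ N)

/-- The smallest real eigenvalue of a square matrix. -/
def lamMin {ι : Type*} [Fintype ι] [DecidableEq ι] (N : Matrix ι ι ℝ) : ℝ := sInf (spectrum ℝ N)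

/-- The data of the problem: minimize `∑ᵢ fᵢ(xᵢ) + ∑ⱼ gⱼ(yⱼ)` subject to
`∑ᵢ Aᵢ xᵢ + ∑ⱼ Bⱼ yⱼ = c`, `xᵢ ∈ Xᵢ`, `yⱼ ∈ Yⱼ`. -/
structure Problem {p q : ℕ} (m : Fin p → ℕ) (d : Fin q → ℕ) (n : ℕ) where
  f : ∀ i, (Fin (m i) → ℝ) → ℝ
  g : ∀ j, (Fin (d j) → ℝ) → ℝ
  A : ∀ i, Matrix (Fin n) (Fin (m i)) ℝ
  B : ∀ j, Matrix (Fin n) (Fin (d j)) ℝ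
  c : Fin n → ℝ
  X : ∀ i, Set (Fin (m i) → ℝ)
  Y : ∀ j, Set (Fin (d j) → ℝ)

/-- The parameters of the method: penalty `β`, dual stepsizes `τ, s`, proximal `σ₁, σ₂`. -/
structure Params where
  β : ℝ
  τ : ℝ
  s : ℝ
  σ₁ : ℝ
  σ₂ : ℝ

/-- The index set of the coordinates of the stacked vector `(x, y, λ)`. -/
abbrev Idx {p q : ℕ} (m : Fin p → ℕ) (d : Fin q → ℕ) (n : ℕ) : Type :=
  (Σ i, Fin (m i)) ⊕ ((Σ j, Fin (d j)) ⊕ Fin n)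

/-- A primal-dual point `w = (x, y, λ)`. -/
@[ext]
structure Point {p q : ℕ} (m : Fin p → ℕ) (d : Fin q → ℕ) (n : ℕ) where
  x : ∀ i, Fin (m i) → ℝ
  y : ∀ j, Fin (d j) → ℝ
  lam : Fin n → ℝ

/-- The point `w` as one column vector. -/
def Point.vec {p q : ℕ} {m : Fin p → ℕ} {d : Fin q → ℕ} {n : ℕ} (w : Point m d n) :
    Idx m d n → ℝ :=
  Sum.elim (fun a => w.x a.1 a.2) (Sum.elim (fun b => w.y b.1 b.2) w.lam)

/-- Admissible parameters: `β > 0`, `σ₁ > p - 1`, `σ₂ > q - 1` and `(τ, s)` in the triangle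
`τ < 1`, `s < 1`, `τ + s > 0`. -/
def Params.Admissible (P : Params) (p q : ℕ) : Prop :=
  0 < P.β ∧ (p : ℝ) - 1 < P.σ₁ ∧ (q : ℝ) - 1 < P.σ₂ ∧ P.τ < 1 ∧ P.s < 1 ∧ 0 < P.τ + P.s

namespace Problem

variable {p q : ℕ} {m : Fin p → ℕ} {d : Fin q → ℕ} {n : ℕ} (S : Problem m d n) (P : Params)

/-- The constraint residual `∑ᵢ Aᵢ xᵢ + ∑ⱼ Bⱼ yⱼ - c`. -/
def residual (x : ∀ i, Fin (m i) → ℝ) (y : ∀ j, Fin (d j) → ℝ) : Fin n → ℝ :=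
  ∑ i, S.A i *ᵥ x i + ∑ j, S.B j *ᵥ y j - S.c

/-- The objective `h(x, y) = ∑ᵢ fᵢ(xᵢ) + ∑ⱼ gⱼ(yⱼ)`. -/
def objective (x : ∀ i, Fin (m i) → ℝ) (y : ∀ j, Fin (d j) → ℝ) : ℝ :=
  ∑ i, S.f i (x i) + ∑ j, S.g j (y j)

/-- Feasibility of `(x, y)` for the primal problem. -/
def Feasible (x : ∀ i, Fin (m i) → ℝ) (y : ∀ j, Fin (d j) → ℝ) : Prop :=
  (∀ i, x i ∈ S.X i) ∧ (∀ j, y j ∈ S.Y j) ∧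
    ∑ i, S.A i *ᵥ x i + ∑ j, S.B j *ᵥ y j = S.c

/-- `(x, y)` is a minimizer of the primal problem. -/
def IsSolution (x : ∀ i, Fin (m i) → ℝ) (y : ∀ j, Fin (d j) → ℝ) : Prop :=
  S.Feasible x y ∧ ∀ x' y', S.Feasible x' y' → S.objective x y ≤ S.objective x' y'

/-- Assumptions on the data: the functions are real-valued and convex on the whole space (hence
closed and proper) with piecewise linear subdifferentials, the constraint sets are polyhedra, all
matrices have full column rank, and the problem has a solution. -/
structure Admissible : Prop where
  convex_f : ∀ i, ConvexOn ℝ univ (S.f i)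
  convex_g : ∀ j, ConvexOn ℝ univ (S.g j)
  piecewise_f : ∀ i, IsPiecewiseLinear (subdifferential (S.f i))
  piecewise_g : ∀ j, IsPiecewiseLinear (subdifferential (S.g j))
  polyhedron_X : ∀ i, IsPolyhedron (S.X i)
  polyhedron_Y : ∀ j, IsPolyhedron (S.Y j)
  rank_A : ∀ i, (S.A i).rank = m i
  rank_B : ∀ j, (S.B j).rank = d j
  solvable : ∃ x y, S.IsSolution x y

/-- The augmented Lagrangian `h(x, y) - ⟨λ, 𝒜x + ℬy - c⟩ + (β/2) ‖𝒜x + ℬy - c‖²`. -/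
def augLagrangian (β : ℝ) (x : ∀ i, Fin (m i) → ℝ) (y : ∀ j, Fin (d j) → ℝ)
    (lam : Fin n → ℝ) : ℝ :=
  S.objective x y - lam ⬝ᵥ S.residual x y + β / 2 * sqNorm (S.residual x y)

/-- The intermediate multiplier `λ^{k+1/2} = λᵏ - τβ(𝒜x⁺ + ℬyᵏ - c)`, where `x⁺ = xᵏ⁺¹`. -/
def lamHalf (w : Point m d n) (xnew : ∀ i, Fin (m i) → ℝ) : Fin n → ℝ :=
  w.lam - (P.τ * P.β) • S.residual xnew w.y

/-- One iteration of GS-ADMM from `w = wᵏ` to `w' = wᵏ⁺¹`. -/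
structure Step (w w' : Point m d n) : Prop where
  x_mem : ∀ i, w'.x i ∈ S.X i
  x_min : ∀ i, IsMinOn (fun ξ : Fin (m i) → ℝ =>
    S.augLagrangian P.β (Function.update w.x i ξ) w.y w.lam
      + P.σ₁ * P.β / 2 * sqNorm (S.A i *ᵥ (ξ - w.x i))) (S.X i) (w'.x i)
  y_mem : ∀ j, w'.y j ∈ S.Y j
  y_min : ∀ j, IsMinOn (fun ξ : Fin (d j) → ℝ =>
    S.augLagrangian P.β w'.x (Function.update w.y j ξ) (S.lamHalf P w w'.x)
      + P.σ₂ * P.β / 2 * sqNorm (S.B j *ᵥ (ξ - w.y j))) (S.Y j) (w'.y j)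
  lam_eq : w'.lam = S.lamHalf P w w'.x - (P.s * P.β) • S.residual w'.x w'.y

/-- `w⁰, w¹, w², …` is a sequence generated by GS-ADMM (from an arbitrary starting point). -/
def IsGSADMM (w : ℕ → Point m d n) : Prop := ∀ k, S.Step P (w k) (w (k + 1))

/-- The set `ℳ = 𝒳 × 𝒴 × ℝⁿ`. -/
def domain : Set (Point m d n) := {w | (∀ i, w.x i ∈ S.X i) ∧ ∀ j, w.y j ∈ S.Y j}

/-- The vector `𝒥(w) = (-𝒜ᵀλ, -ℬᵀλ, 𝒜x + ℬy - c)`. -/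
def J (w : Point m d n) : Idx m d n → ℝ :=
  Point.vec (m := m) (d := d) ⟨fun i => -((S.A i)ᵀ *ᵥ w.lam), fun j => -((S.B j)ᵀ *ᵥ w.lam),
    S.residual w.x w.y⟩

/-- The solution set `ℳ*` of the associated variational inequality. -/
def solutionSet : Set (Point m d n) :=
  {v | v ∈ S.domain ∧ ∀ w ∈ S.domain,
    0 ≤ S.objective w.x w.y - S.objective v.x v.y + (w.vec - v.vec) ⬝ᵥ S.J w}

/-- The row of blocks `ℬ = [B₁, …, B_q]`. -/
def rowB : Matrix (Fin n) (Σ j, Fin (d j)) ℝ := Matrix.of fun r b => S.B b.1 r b.2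

/-- The block matrix with diagonal blocks `σ₁ β Aᵢᵀ Aᵢ` and off-diagonal blocks `-β Aᵢᵀ Aₗ`. -/
def Hx : Matrix (Σ i, Fin (m i)) (Σ i, Fin (m i)) ℝ := Matrix.of fun a b =>
  P.β * ((if a.1 = b.1 then P.σ₁ else -1) * ((S.A a.1)ᵀ * S.A b.1) a.2 b.2)

/-- The block diagonal matrix with blocks `(σ₂ + 1) β Bⱼᵀ Bⱼ`. -/
def Dy : Matrix (Σ j, Fin (d j)) (Σ j, Fin (d j)) ℝ := Matrix.of fun a b =>
  if a.1 = b.1 then (P.σ₂ + 1) * P.β * ((S.B a.1)ᵀ * S.B b.1) a.2 b.2 else 0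

/-- The matrix `Q`. -/
def Q : Matrix (Idx m d n) (Idx m d n) ℝ :=
  fromBlocks (S.Hx P) 0 0
    (fromBlocks (S.Dy P) (-P.τ • S.rowBᵀ) (-S.rowB) ((1 / P.β) • (1 : Matrix (Fin n) (Fin n) ℝ)))

/-- The matrix `M`. -/
def M : Matrix (Idx m d n) (Idx m d n) ℝ :=
  fromBlocks 1 0 0
    (fromBlocks 1 0 (-(P.s * P.β) • S.rowB) ((P.τ + P.s) • (1 : Matrix (Fin n) (Fin n) ℝ)))

/-- The matrix `G = Q + Qᵀ - Mᵀ Q`. -/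
def G : Matrix (Idx m d n) (Idx m d n) ℝ := S.Q P + (S.Q P)ᵀ - (S.M P)ᵀ * S.Q P

/-- The matrix `H = Q M⁻¹`. -/
def H : Matrix (Idx m d n) (Idx m d n) ℝ := S.Q P * (S.M P)⁻¹

/-- The distance `‖w - v‖_H = √((w - v)ᵀ H (w - v))`. -/
def distH (w v : Point m d n) : ℝ := √((w.vec - v.vec) ⬝ᵥ (S.H P *ᵥ (w.vec - v.vec)))

/-- The distance `dist_H(w, ℳ*)` from a point to the solution set. -/
def distHSol (w : Point m d n) : ℝ := sInf ((fun v => S.distH P w v) '' S.solutionSet)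

/-- `μᵢ = λ_max(Aᵢᵀ Aᵢ)`. -/
def mu (i : Fin p) : ℝ := lamMax ((S.A i)ᵀ * S.A i)

/-- `νⱼ = λ_max(Bⱼᵀ Bⱼ)`. -/
def nu (j : Fin q) : ℝ := lamMax ((S.B j)ᵀ * S.B j)

/-- The constant `θ̄ᵢ`. -/
def thetaBar (i : Fin p) : ℝ :=
  4 * p * (1 - P.σ₁) ^ 2 * P.β ^ 2 * ∑ l, S.mu l + 4 * P.β ^ 2 * S.mu i

/-- The constant `ϑ̄ⱼ`. -/
def varthetaBar (j : Fin q) : ℝ :=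
  4 * q * (P.s * P.β) ^ 2 * ∑ l, S.mu l + 3 * q * (P.s * P.β) ^ 2 * ∑ l, S.nu l
    + 3 * (P.σ₂ + 1) ^ 2 * P.β ^ 2 * S.nu j + 2 * q

/-- The constant `η̄`. -/
def etaBar : ℝ :=
  4 * (P.τ + P.s - 1) ^ 2 * ∑ l, S.mu l + 3 * (P.s - 1) ^ 2 * ∑ l, S.nu l + 2 / P.β ^ 2

/-- `δ = max {θ̄ᵢ, ϑ̄ⱼ, η̄}`. -/
def delta : ℝ := max (max (⨆ i, S.thetaBar P i) (⨆ j, S.varthetaBar P j)) (S.etaBar P)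

/-- `max {δ μᵢ, δ νⱼ, δ}`. -/
def kappa : ℝ :=
  max (max (⨆ i, S.delta P * S.mu i) (⨆ j, S.delta P * S.nu j)) (S.delta P)

/-- `ε = λ_min(G) / (ζ² max {δ μᵢ, δ νⱼ, δ} λ_max(H))`. -/
def eps (ζ : ℝ) : ℝ := lamMin (S.G P) / (ζ ^ 2 * S.kappa P * lamMax (S.H P))

/-- The rate `r = 1 / √(1 + ε)`. -/
def rate (ζ : ℝ) : ℝ := 1 / √(1 + S.eps P ζ)

/-- The constant `C = 2 dist_H(w⁰, ℳ*) / (1 - r)`. -/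
def bigC (ζ : ℝ) (w₀ : Point m d n) : ℝ := 2 * S.distHSol P w₀ / (1 - S.rate P ζ)

/-- The defining property of the constant `ζ` in `ε`:
`dist_H²(wᵏ⁺¹, ℳ*) ≤ (1 / (1 + ε)) dist_H²(wᵏ, ℳ*)` for all `k`. -/
def Contracts (ζ : ℝ) (w : ℕ → Point m d n) : Prop :=
  ∀ k, S.distHSol P (w (k + 1)) ^ 2 ≤ 1 / (1 + S.eps P ζ) * S.distHSol P (w k) ^ 2

/-- R-linear convergence of `w` to a point of `ℳ*`, with the explicit rate `r` and constant `C`. -/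
def ConvergesRLinearly (ζ : ℝ) (w : ℕ → Point m d n) : Prop :=
  ∃ wInf ∈ S.solutionSet,
    Tendsto (fun k => (w k).vec) atTop (𝓝 wInf.vec) ∧
    ∀ k, S.distH P (w k) wInf ≤ S.bigC P ζ (w 0) * S.rate P ζ ^ k

end Problem

end GSADMM

end

/-!
The method is a prediction-correction scheme in the `H`-metric, and everything follows from a Fejér
inequality combined with an error bound.

*Fejér inequality.* Let `w̃ = (xᵏ⁺¹, yᵏ⁺¹, λᵏ - β (𝒜xᵏ⁺¹ + ℬyᵏ - c))`. The optimality conditions of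
the subproblems say exactly that `w̃` solves the variational inequality defining `ℳ*` with `𝒥`
perturbed by the constant vector `Q (w̃ - wᵏ)` (`Step.solvesVI`), while the multiplier updates
amount to `wᵏ - wᵏ⁺¹ = M (wᵏ - w̃)` (`Step.sub_eq`). As `𝒥` is affine with skew linear part and
`Q = H M`, this yields `‖wᵏ⁺¹ - w*‖²_H + ‖wᵏ - w̃‖²_G ≤ ‖wᵏ - w*‖²_H` for all `w* ∈ ℳ*`
(`Step.sq_dist_add_le`). Definiteness of `H` and `G` is seen by completing a square in `λ`; for `H`
one substitutes `v = M z`, which turns `vᵀ H v` into `(M z)ᵀ Q z` and avoids inverting `M`.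

*Error bound.* The perturbed variational inequality decouples into inclusions in `∂fᵢ + N_{Xᵢ}` and
`∂gⱼ + N_{Yⱼ}` and one linear equation (`solvesVI_iff`), so the graph of its solution mapping is a
finite union of polyhedra (`Admissible.solvesVI_graph`). By Robinson's theorem
(`IsPolyhedralUnion.upper_lipschitz`) a point that solves it with a small perturbation `ξ` lies
within a multiple of `‖ξ‖` of `ℳ*`. The polyhedral facts used here (projections, Farkas' lemma,
Lagrange multipliers without constraint qualification, the upper Lipschitz property) all rest on
Fourier–Motzkin elimination (`IsPolyhedron.exists_real`).

With both, `dist_H(wᵏ⁺¹, ℳ*)²` is at most a multiple of `‖wᵏ - w̃‖²_G`; where the perturbation is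
not small, this holds because the distances are bounded by `R`. Hence one step contracts the squared
distance by a factor `1 / (1 + ε)` depending only on `R` (`exists_contraction`). Since `ε(ζ)` is a
positive constant divided by `ζ²`, a suitable `ζ` realizes this factor. Finally, Fejér monotonicity
bounds each step by twice the distance to `ℳ*`, so geometric decay of the distances makes the
iterates a Cauchy sequence with the stated rate and constant (`exists_limit_of_fejer`).
-/

namespace GSADMM

/-! ### Polyhedra and their projections -/

section Polyhedra

variable {V W : Type*} [AddCommGroup V] [Module ℝ V] [AddCommGroup W] [Module ℝ W]

theorem isPolyhedron_setOf_forall_le {ι : Type*} [Finite ι] (a : ι → V →ₗ[ℝ] ℝ) (b : ι → ℝ) :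
    IsPolyhedron {v | ∀ i, a i v ≤ b i} := by
  obtain ⟨N, ⟨e⟩⟩ := Finite.exists_equiv_fin ι
  refine ⟨N, fun t => a (e.symm t), fun t => b (e.symm t), ?_⟩
  ext v
  exact ⟨fun h t => h _, fun h i => by simpa using h (e i)⟩

theorem IsPolyhedron.preimage {K : Set W} (hK : IsPolyhedron K) (L : V →ₗ[ℝ] W) :
    IsPolyhedron (L ⁻¹' K) := by
  obtain ⟨N, a, b, rfl⟩ := hK
  exact ⟨N, fun t => a t ∘ₗ L, b, rfl⟩

theorem IsPolyhedron.iInter {ι : Type*} [Finite ι] {K : ι → Set V}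
    (hK : ∀ i, IsPolyhedron (K i)) : IsPolyhedron (⋂ i, K i) := by
  choose N a b h using hK
  have := isPolyhedron_setOf_forall_le (ι := Σ i, Fin (N i)) (fun t => a t.1 t.2)
    (fun t => b t.1 t.2)
  convert this using 1
  ext v
  simp only [h, mem_iInter, mem_ofPred_eq]
  exact ⟨fun h t => h t.1 t.2, fun h i t => h ⟨i, t⟩⟩

theorem IsPolyhedron.inter {K L : Set V} (hK : IsPolyhedron K) (hL : IsPolyhedron L) :
    IsPolyhedron (K ∩ L) := by
  rw [inter_eq_iInter]
  exact IsPolyhedron.iInter fun b => by cases b <;> assumption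

theorem IsPolyhedron.convex {K : Set V} (hK : IsPolyhedron K) : Convex ℝ K := by
  obtain ⟨N, a, b, rfl⟩ := hK
  rw [ofPred_forall]
  exact convex_iInter fun t => convex_halfSpace_le (a t).isLinear (b t)

theorem IsPolyhedron.isClosed {E : Type*} [NormedAddCommGroup E] [NormedSpace ℝ E]
    [FiniteDimensional ℝ E] {K : Set E} (hK : IsPolyhedron K) : IsClosed K := by
  obtain ⟨N, a, b, rfl⟩ := hK
  rw [ofPred_forall]
  exact isClosed_iInter fun t =>
    isClosed_le (a t).continuous_of_finiteDimensional continuous_const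

theorem isPolyhedron_singleton [FiniteDimensional ℝ V] (c : V) : IsPolyhedron {c} := by
  let B := Module.finBasis ℝ V
  have h := (isPolyhedron_setOf_forall_le (fun i => B.coord i) (fun i => B.coord i c)).inter
    (isPolyhedron_setOf_forall_le (fun i => -B.coord i) (fun i => -B.coord i c))
  convert h using 1
  ext v
  constructor
  · rintro rfl
    simp
  · rintro ⟨h1, h2⟩
    refine B.ext_elem fun i => le_antisymm (h1 i) ?_
    have := h2 i
    simpa using this

/-- Fourier–Motzkin elimination of one real variable: a constraint bounding it from above is
combined with each constraint bounding it from below. -/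
theorem IsPolyhedron.exists_real {K : Set (V × ℝ)} (hK : IsPolyhedron K) :
    IsPolyhedron {v | ∃ r, (v, r) ∈ K} := by
  obtain ⟨N, a, b, rfl⟩ := hK
  let α : Fin N → V →ₗ[ℝ] ℝ := fun t => a t ∘ₗ LinearMap.inl ℝ V ℝ
  let γ : Fin N → ℝ := fun t => a t (0, 1)
  have hα : ∀ t v r, a t (v, r) = α t v + γ t * r := by
    intro t v r
    have : ((v, r) : V × ℝ) = (v, 0) + r • (0, 1) := by simp
    rw [this, map_add, map_smul, smul_eq_mul, mul_comm]
    rfl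
  have h1 := isPolyhedron_setOf_forall_le (ι := {t // γ t = 0}) (fun t => α t) (fun t => b t)
  have h2 := isPolyhedron_setOf_forall_le (ι := {t // 0 < γ t} × {t // γ t < 0})
    (fun z => γ z.1 • α z.2 - γ z.2 • α z.1) (fun z => γ z.1 * b z.2 - γ z.2 * b z.1)
  convert h1.inter h2 using 1
  ext v
  simp only [mem_ofPred_eq, mem_inter_iff, hα, Subtype.forall, Prod.forall, LinearMap.sub_apply,
    LinearMap.smul_apply, smul_eq_mul]
  constructor
  · rintro ⟨r, hr⟩
    refine ⟨fun t ht => by simpa [ht] using hr t, fun s hs t ht => ?_⟩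
    have e1 := mul_le_mul_of_nonneg_left (hr t) hs.le
    have e2 := mul_le_mul_of_nonpos_left (hr s) ht.le
    nlinarith
  · rintro ⟨h0, hst⟩
    let up : Set ℝ := (fun t => (b t - α t v) / γ t) '' {t | 0 < γ t}
    let lo : Set ℝ := (fun t => (b t - α t v) / γ t) '' {t | γ t < 0}
    have hlu : ∀ x ∈ lo, ∀ y ∈ up, x ≤ y := by
      rintro _ ⟨t, ht, rfl⟩ _ ⟨s, hs, rfl⟩
      have ht' : γ t < 0 := ht
      have hs' : 0 < γ s := hs
      have := hst s hs t ht
      show (b t - α t v) / γ t ≤ (b s - α s v) / γ s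
      rw [le_div_iff₀ hs', div_mul_eq_mul_div, div_le_iff_of_neg ht']
      nlinarith
    have hup : up.Finite := (toFinite _).image _
    have hlo : lo.Finite := (toFinite _).image _
    obtain ⟨r, hrl, hru⟩ : ∃ r, (∀ x ∈ lo, x ≤ r) ∧ ∀ y ∈ up, r ≤ y := by
      rcases lo.eq_empty_or_nonempty with hl | hl
      · obtain ⟨r, hr⟩ := hup.bddBelow
        exact ⟨r, by simp [hl], fun y hy => hr hy⟩
      rcases up.eq_empty_or_nonempty with hu | hu
      · obtain ⟨r, hr⟩ := hlo.bddAbove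
        exact ⟨r, fun y hy => hr hy, by simp [hu]⟩
      obtain ⟨r, h1, h2⟩ := exists_between_of_forall_le hl hu hlu
      exact ⟨r, fun x hx => h1 hx, fun y hy => h2 hy⟩
    refine ⟨r, fun t => ?_⟩
    rcases lt_trichotomy (γ t) 0 with ht | ht | ht
    · have := hrl _ ⟨t, ht, rfl⟩
      rw [div_le_iff_of_neg ht] at this
      linarith
    · simpa [ht] using h0 t ht
    · have := hru _ ⟨t, ht, rfl⟩
      rw [le_div_iff₀ ht] at this
      linarith

theorem IsPolyhedron.exists_pi {k : ℕ} {K : Set (V × (Fin k → ℝ))} (hK : IsPolyhedron K) :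
    IsPolyhedron {v | ∃ u, (v, u) ∈ K} := by
  induction k with
  | zero =>
    convert hK.preimage (LinearMap.inl ℝ V (Fin 0 → ℝ)) using 1
    ext v
    constructor
    · rintro ⟨u, hu⟩
      rwa [Subsingleton.elim u 0] at hu
    · exact fun h => ⟨0, h⟩
  | succ k ih =>
    let L : (V × (Fin k → ℝ)) × ℝ →ₗ[ℝ] V × (Fin (k + 1) → ℝ) :=
      LinearMap.prod (LinearMap.fst ℝ _ _ ∘ₗ LinearMap.fst ℝ _ _)
        ((Fin.consLinearEquiv ℝ fun _ : Fin (k + 1) => ℝ).toLinearMap ∘ₗ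
          LinearMap.prod (LinearMap.snd ℝ _ _) (LinearMap.snd ℝ _ _ ∘ₗ LinearMap.fst ℝ _ _))
    convert ih (hK.preimage L).exists_real using 1
    ext v
    constructor
    · rintro ⟨u, hu⟩
      refine ⟨Fin.tail u, u 0, ?_⟩
      show (v, Fin.cons (u 0) (Fin.tail u)) ∈ K
      rwa [Fin.cons_self_tail]
    · rintro ⟨u, r, h⟩
      exact ⟨_, h⟩

/-- The projection of a polyhedron along a finite-dimensional space is a polyhedron. -/
theorem IsPolyhedron.exists_snd [FiniteDimensional ℝ W] {K : Set (V × W)} (hK : IsPolyhedron K) :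
    IsPolyhedron {v | ∃ u, (v, u) ∈ K} := by
  let e := (Module.finBasis ℝ W).equivFun
  convert (hK.preimage (LinearMap.prodMap (LinearMap.id : V →ₗ[ℝ] V)
    e.symm.toLinearMap)).exists_pi using 1
  ext v
  constructor
  · rintro ⟨u, hu⟩
    exact ⟨e u, by simpa using hu⟩
  · rintro ⟨u, hu⟩
    exact ⟨_, hu⟩

/-- A finitely generated cone is a polyhedron. -/
theorem isPolyhedron_cone [FiniteDimensional ℝ V] {ι : Type*} [Fintype ι] (a : ι → V) :
    IsPolyhedron {v | ∃ y : ι → ℝ, (∀ i, 0 ≤ y i) ∧ v = ∑ i, y i • a i} := by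
  let L : V × (ι → ℝ) →ₗ[ℝ] V :=
    LinearMap.fst ℝ _ _ - Fintype.linearCombination ℝ a ∘ₗ LinearMap.snd ℝ _ _
  have h1 := (isPolyhedron_singleton (0 : V)).preimage L
  have h2 := isPolyhedron_setOf_forall_le (V := V × (ι → ℝ))
    (fun i : ι => -(LinearMap.proj i ∘ₗ LinearMap.snd ℝ V (ι → ℝ))) (fun _ => 0)
  convert (h1.inter h2).exists_snd using 1
  ext v
  simp [L, Fintype.linearCombination_apply, sub_eq_zero, and_comm]

/-- Farkas' lemma. -/
theorem farkas [FiniteDimensional ℝ V] {ι : Type*} [Fintype ι] (a : ι → V →ₗ[ℝ] ℝ)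
    (ν : V →ₗ[ℝ] ℝ) (h : ∀ v, (∀ i, a i v ≤ 0) → ν v ≤ 0) :
    ∃ y : ι → ℝ, (∀ i, 0 ≤ y i) ∧ ν = ∑ i, y i • a i := by
  classical
  obtain ⟨N, φ, b, hφ⟩ := isPolyhedron_cone a
  change ν ∈ {v | ∃ y : ι → ℝ, (∀ i, 0 ≤ y i) ∧ v = ∑ i, y i • a i}
  rw [hφ]
  intro t
  have hb : 0 ≤ b t := by
    have : (0 : V →ₗ[ℝ] ℝ) ∈ {v | ∃ y : ι → ℝ, (∀ i, 0 ≤ y i) ∧ v = ∑ i, y i • a i} :=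
      ⟨0, by simp, by simp⟩
    rw [hφ] at this
    simpa using this t
  refine le_trans ?_ hb
  let v := (Module.evalEquiv ℝ V).symm (φ t)
  have hv : ∀ ψ : V →ₗ[ℝ] ℝ, φ t ψ = ψ v := fun ψ =>
    (Module.apply_evalEquiv_symm_apply ℝ V ψ (φ t)).symm
  rw [hv]
  refine h v fun i => ?_
  -- a functional bounded above on a ray is nonpositive along it
  by_contra! hi
  have hmem : ((|b t| + 1) / a i v) • a i ∈
      {v | ∃ y : ι → ℝ, (∀ i, 0 ≤ y i) ∧ v = ∑ i, y i • a i} := by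
    refine ⟨Pi.single i ((|b t| + 1) / a i v), fun j => ?_, ?_⟩
    · by_cases hj : j = i
      · subst hj
        simp only [Pi.single_eq_same]
        positivity
      · simp [Pi.single_eq_of_ne hj]
    · rw [Finset.sum_eq_single i] <;> simp +contextual [Pi.single_eq_of_ne]
  rw [hφ] at hmem
  have := hmem t
  rw [hv, LinearMap.smul_apply, smul_eq_mul, div_mul_cancel₀ _ hi.ne'] at this
  linarith [le_abs_self (b t)]

/-- The normal cone of a polyhedron at `x` is generated by the constraints active at `x`. -/
theorem exists_multipliers [FiniteDimensional ℝ V] {ι : Type*} [Fintype ι]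
    (a : ι → V →ₗ[ℝ] ℝ) (b : ι → ℝ) {x : V} (hx : ∀ i, a i x ≤ b i) (ν : V →ₗ[ℝ] ℝ)
    (h : ∀ v, (∀ i, a i v ≤ b i) → ν (v - x) ≤ 0) :
    ∃ y : ι → ℝ, (∀ i, 0 ≤ y i) ∧ (∀ i, y i ≠ 0 → a i x = b i) ∧ ν = ∑ i, y i • a i := by
  classical
  obtain ⟨y, hy0, hy⟩ := farkas (fun i : {i // a i x = b i} => a i) ν fun v hv => by
    -- a short step along `v` stays in the polyhedron
    have hstep : ∀ᶠ t in 𝓝[>] (0 : ℝ), ∀ i, a i (x + t • v) ≤ b i := by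
      refine eventually_all.2 fun i => ?_
      rcases (hx i).eq_or_lt with hi | hi
      · filter_upwards [self_mem_nhdsWithin] with t ht
        have := mul_nonpos_of_nonneg_of_nonpos (le_of_lt ht) (hv ⟨i, hi⟩)
        simp only [map_add, map_smul, smul_eq_mul]
        linarith
      · have hc : Tendsto (fun t : ℝ => a i (x + t • v)) (𝓝 0) (𝓝 (a i x)) := by
          have : Continuous fun t : ℝ => a i x + t * a i v := by fun_prop
          simpa using this.tendsto 0
        exact ((hc.eventually_lt_const hi).mono fun _ => le_of_lt).filter_mono
          nhdsWithin_le_nhds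
    obtain ⟨t, ht, ht0⟩ := (hstep.and self_mem_nhdsWithin).exists
    have := h _ ht
    rw [add_sub_cancel_left, map_smul, smul_eq_mul] at this
    exact nonpos_of_mul_nonpos_right this ht0
  refine ⟨fun i => if hi : a i x = b i then y ⟨i, hi⟩ else 0, fun i => ?_, fun i hi => ?_, ?_⟩
  · dsimp only
    split_ifs
    exacts [hy0 _, le_rfl]
  · by_contra hne
    exact hi (dif_neg hne)
  · rw [hy, ← Fintype.sum_subtype_add_sum_subtype (fun i => a i x = b i),
      Fintype.sum_eq_zero (fun i : {i // ¬a i x = b i} => _) fun i => by simp [dif_neg i.2],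
      add_zero]
    exact Fintype.sum_congr _ _ fun i => by simp [dif_pos i.2]

/-- A finite union of polyhedra. -/
def IsPolyhedralUnion (K : Set V) : Prop :=
  ∃ (N : ℕ) (P : Fin N → Set V), (∀ t, IsPolyhedron (P t)) ∧ K = ⋃ t, P t

theorem isPolyhedralUnion_iUnion {ι : Type*} [Finite ι] {P : ι → Set V}
    (hP : ∀ i, IsPolyhedron (P i)) : IsPolyhedralUnion (⋃ i, P i) := by
  obtain ⟨N, ⟨e⟩⟩ := Finite.exists_equiv_fin ι
  exact ⟨N, fun t => P (e.symm t), fun t => hP _, (e.symm.surjective.iUnion_comp P).symm⟩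

theorem IsPolyhedron.isPolyhedralUnion {K : Set V} (hK : IsPolyhedron K) :
    IsPolyhedralUnion K :=
  ⟨1, fun _ => K, fun _ => hK, (iUnion_const K).symm⟩

theorem IsPolyhedralUnion.preimage {K : Set W} (hK : IsPolyhedralUnion K) (L : V →ₗ[ℝ] W) :
    IsPolyhedralUnion (L ⁻¹' K) := by
  obtain ⟨N, P, hP, rfl⟩ := hK
  rw [preimage_iUnion]
  exact isPolyhedralUnion_iUnion fun t => (hP t).preimage L

theorem IsPolyhedralUnion.iInter {ι : Type*} [Finite ι] {K : ι → Set V}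
    (hK : ∀ i, IsPolyhedralUnion (K i)) : IsPolyhedralUnion (⋂ i, K i) := by
  choose N P hP h using hK
  convert isPolyhedralUnion_iUnion (ι := ∀ i, Fin (N i)) (P := fun c => ⋂ i, P i (c i))
    (fun c => IsPolyhedron.iInter fun i => hP i (c i)) using 1
  ext v
  simp only [h, mem_iInter, mem_iUnion]
  exact Classical.skolem

theorem IsPolyhedralUnion.inter {K L : Set V} (hK : IsPolyhedralUnion K)
    (hL : IsPolyhedralUnion L) : IsPolyhedralUnion (K ∩ L) := by
  rw [inter_eq_iInter]
  exact IsPolyhedralUnion.iInter fun b => by cases b <;> assumption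

theorem IsPolyhedralUnion.exists_snd [FiniteDimensional ℝ W] {K : Set (V × W)}
    (hK : IsPolyhedralUnion K) : IsPolyhedralUnion {v | ∃ u, (v, u) ∈ K} := by
  obtain ⟨N, P, hP, rfl⟩ := hK
  convert isPolyhedralUnion_iUnion fun t => (hP t).exists_snd using 1
  ext v
  simp only [mem_iUnion, mem_ofPred_eq]
  exact exists_comm

end Polyhedra

/-! ### Upper Lipschitz continuity of polyhedral multifunctions -/

/-- One piece of `IsPolyhedralUnion.upper_lipschitz`. The set of all `(v, ξ, r)` such that some
`v'` with `(v', ξ) ∈ K` has distance at most `r` from `v` is a polyhedron, and the bound can be read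
off from its inequalities. -/
theorem IsPolyhedron.upper_lipschitz {ι : Type*} [Fintype ι] {W : Type*} [NormedAddCommGroup W]
    [NormedSpace ℝ W] [FiniteDimensional ℝ W] {K : Set ((ι → ℝ) × W)} (hK : IsPolyhedron K) :
    ∃ κ > 0, ∃ ρ > 0, ∀ v ξ, (v, ξ) ∈ K → ‖ξ‖ < ρ → ∃ v', (v', 0) ∈ K ∧ ‖v - v'‖ ≤ κ * ‖ξ‖ := by
  by_cases h0 : ∃ v, (v, (0 : W)) ∈ K
  · obtain ⟨v₀, hv₀⟩ := h0
    let V := ι → ℝ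
    have hS : IsPolyhedron {z : (V × W) × ℝ |
        ∃ v', (v', z.1.2) ∈ K ∧ ∀ i, |z.1.1 i - v' i| ≤ z.2} := by
      let L : ((V × W) × ℝ) × V →ₗ[ℝ] V × W :=
        LinearMap.prod (LinearMap.snd ℝ _ _)
          (LinearMap.snd ℝ _ _ ∘ₗ LinearMap.fst ℝ _ _ ∘ₗ LinearMap.fst ℝ _ _)
      let D : ι → ((V × W) × ℝ) × V →ₗ[ℝ] ℝ := fun i =>
        LinearMap.proj i ∘ₗ (LinearMap.fst ℝ _ _ ∘ₗ LinearMap.fst ℝ _ _ ∘ₗ LinearMap.fst ℝ _ _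
          - LinearMap.snd ℝ _ _)
      let r : ((V × W) × ℝ) × V →ₗ[ℝ] ℝ := LinearMap.snd ℝ _ _ ∘ₗ LinearMap.fst ℝ _ _
      convert ((hK.preimage L).inter ((isPolyhedron_setOf_forall_le (fun i => D i - r)
        (fun _ => 0)).inter (isPolyhedron_setOf_forall_le (fun i => -D i - r)
        (fun _ => 0)))).exists_snd using 1
      ext z
      simp only [mem_ofPred_eq, mem_inter_iff, mem_preimage]
      refine exists_congr fun v' => and_congr Iff.rfl ?_
      rw [← forall_and]
      refine forall_congr' fun i => ?_
      show _ ↔ (z.1.1 i - v' i) - z.2 ≤ 0 ∧ -(z.1.1 i - v' i) - z.2 ≤ 0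
      rw [abs_le]
      constructor <;> rintro ⟨h1, h2⟩ <;> constructor <;> linarith
    obtain ⟨N, a, b, hab⟩ := hS
    have hmem : ∀ v ξ r, (∃ v', (v', ξ) ∈ K ∧ ∀ i, |v i - v' i| ≤ r) ↔
        ∀ t, a t ((v, ξ), r) ≤ b t := fun v ξ r => by
      have := Set.ext_iff.1 hab ((v, ξ), r)
      simpa using this
    have hsplit : ∀ t v ξ r, a t ((v, ξ), r) =
        a t ((v, 0), 0) + a t ((0, ξ), 0) + r * a t ((0, 0), 1) := by
      intro t v ξ r
      rw [← smul_eq_mul, ← map_smul, ← map_add, ← map_add]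
      simp
    have hzero : ∀ t, a t ((0, (0 : W)), (0 : ℝ)) = 0 := fun t => map_zero (a t)
    have hlim : ∀ t v r, ‖v - v₀‖ ≤ r → a t ((v, 0), 0) + r * a t ((0, 0), 1) ≤ b t := by
      intro t v r hr
      have := (hmem v 0 r).1 ⟨v₀, hv₀, fun i => (norm_le_pi_norm (v - v₀) i).trans hr⟩ t
      rwa [hsplit, hzero, add_zero] at this
    have hγ : ∀ t, a t ((0, 0), 1) ≤ 0 := by
      intro t
      by_contra! h
      have h1 := hlim t v₀ ((|b t - a t ((v₀, 0), 0)| + 1) / a t ((0, 0), 1)) (by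
        rw [sub_self, norm_zero]; positivity)
      rw [div_mul_cancel₀ _ h.ne'] at h1
      linarith [le_abs_self (b t - a t ((v₀, 0), 0))]
    have hκ : ∀ t, ∃ κ ≥ 0, ∀ v ξ, (v, ξ) ∈ K → ∀ r, κ * ‖ξ‖ ≤ r → a t ((v, 0), r) ≤ b t := by
      intro t
      rcases (hγ t).eq_or_lt with h | h
      · refine ⟨0, le_rfl, fun v ξ _ r _ => ?_⟩
        have := hlim t v _ le_rfl
        rw [hsplit, h, hzero]
        rw [h] at this
        linarith
      · let ψ : W →L[ℝ] ℝ := LinearMap.toContinuousLinearMap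
          (a t ∘ₗ LinearMap.inl ℝ _ _ ∘ₗ LinearMap.inr ℝ _ _)
        refine ⟨‖ψ‖ / -a t ((0, 0), 1), div_nonneg (norm_nonneg _) (by linarith),
          fun v ξ hv r hr => ?_⟩
        have h1 := (hmem v ξ 0).1 ⟨v, hv, by simp⟩ t
        rw [hsplit] at h1 ⊢
        have h2 : -(‖ψ‖ * ‖ξ‖) ≤ a t ((0, ξ), 0) := by
          have := ψ.le_opNorm ξ
          rw [Real.norm_eq_abs] at this
          exact (abs_le.1 this).1
        rw [div_mul_eq_mul_div, div_le_iff₀ (by linarith)] at hr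
        rw [hzero]
        linarith
    choose κ hκ0 hκ using hκ
    have hsum := Finset.sum_nonneg fun t (_ : t ∈ Finset.univ) => hκ0 t
    refine ⟨∑ t, κ t + 1, by linarith, 1, one_pos, fun v ξ hv _ => ?_⟩
    obtain ⟨v', hv', hd⟩ := (hmem v 0 ((∑ t, κ t + 1) * ‖ξ‖)).2 fun t =>
      hκ t v ξ hv _ <| by
        gcongr
        have := Finset.single_le_sum (fun t _ => hκ0 t) (Finset.mem_univ t)
        linarith
    refine ⟨v', hv', (pi_norm_le_iff_of_nonneg ?_).2 hd⟩
    positivity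
  · -- the values `ξ` that occur form a closed set, so they stay away from `0`
    have hpr := (hK.preimage (LinearMap.prod (LinearMap.snd ℝ W (ι → ℝ))
      (LinearMap.fst ℝ _ _))).exists_snd.isClosed
    have h0' : (0 : W) ∈ {w | ∃ u, (w, u) ∈ (LinearMap.prod (LinearMap.snd ℝ W (ι → ℝ))
      (LinearMap.fst ℝ _ _)) ⁻¹' K}ᶜ := h0
    obtain ⟨ρ, hρ, hsub⟩ := Metric.isOpen_iff.1 hpr.isOpen_compl 0 h0'
    exact ⟨1, one_pos, ρ, hρ, fun v ξ hv hξ =>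
      (hsub (mem_ball_zero_iff.2 hξ) ⟨v, hv⟩).elim⟩

/-- A multifunction `ξ ↦ {v | (v, ξ) ∈ K}` whose graph is a finite union of polyhedra is upper
Lipschitz continuous at `0` (Robinson). -/
theorem IsPolyhedralUnion.upper_lipschitz {ι : Type*} [Fintype ι] {W : Type*}
    [NormedAddCommGroup W] [NormedSpace ℝ W] [FiniteDimensional ℝ W] {K : Set ((ι → ℝ) × W)}
    (hK : IsPolyhedralUnion K) :
    ∃ κ > 0, ∃ ρ > 0, ∀ v ξ, (v, ξ) ∈ K → ‖ξ‖ < ρ → ∃ v', (v', 0) ∈ K ∧ ‖v - v'‖ ≤ κ * ‖ξ‖ := by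
  obtain ⟨N, P, hP, rfl⟩ := hK
  choose κ hκ ρ hρ h using fun t => (hP t).upper_lipschitz
  obtain ⟨ρ₀, hρ₀, hle⟩ : ∃ ρ₀ > 0, ∀ t, ρ₀ ≤ ρ t := by
    obtain ⟨x, hx⟩ := ((eventually_all.2 fun t => eventually_le_nhds (hρ t)).filter_mono
      nhdsWithin_le_nhds |>.and (self_mem_nhdsWithin (a := (0 : ℝ)) (s := Ioi 0))).exists
    exact ⟨x, hx.2, hx.1⟩
  have hsum := Finset.sum_nonneg fun t (_ : t ∈ Finset.univ) => (hκ t).le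
  refine ⟨∑ t, κ t + 1, by linarith, ρ₀, hρ₀, fun v ξ hv hξ => ?_⟩
  obtain ⟨t, ht⟩ := mem_iUnion.1 hv
  obtain ⟨v', hv', hd⟩ := h t v ξ ht (hξ.trans_le (hle t))
  refine ⟨v', mem_iUnion.2 ⟨t, hv'⟩, hd.trans ?_⟩
  gcongr
  have := Finset.single_le_sum (fun t _ => (hκ t).le) (Finset.mem_univ t)
  linarith

/-! ### Optimality conditions for convex functions over polyhedra -/

section Convex

theorem continuous_of_convexOn {E : Type*} [NormedAddCommGroup E] [NormedSpace ℝ E]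
    [FiniteDimensional ℝ E] {f : E → ℝ} (hf : ConvexOn ℝ univ f) : Continuous f :=
  continuousOn_univ.1 (hf.continuousOn isOpen_univ)

/-- A minimizer `x` of `f` over `K` admits a subgradient `e` of `f` at `x` with `-e` normal to `K`
at `x`. The functional separates the strict epigraph of `f` from `K × (-∞, f x]`. -/
theorem exists_subgradient {E : Type*} [NormedAddCommGroup E] [NormedSpace ℝ E]
    [FiniteDimensional ℝ E] {f : E → ℝ} (hf : ConvexOn ℝ univ f) {K : Set E} (hK : Convex ℝ K)
    {x : E} (hx : x ∈ K) (hmin : IsMinOn f K x) :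
    ∃ e : E →ₗ[ℝ] ℝ, (∀ v, f x + e (v - x) ≤ f v) ∧ ∀ v ∈ K, 0 ≤ e (v - x) := by
  have hC : Convex ℝ {z : E × ℝ | f z.1 < z.2} := by
    have := hf.convex_strict_epigraph
    simpa using this
  have hCo : IsOpen {z : E × ℝ | f z.1 < z.2} :=
    isOpen_lt ((continuous_of_convexOn hf).comp continuous_fst) continuous_snd
  obtain ⟨φ, u, h1, h2⟩ := geometric_hahn_banach_open hC hCo (hK.prod (convex_Iic (f x))) <| by
    rw [Set.disjoint_left]
    rintro ⟨v, r⟩ hv ⟨hv1, hv2⟩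
    exact (isMinOn_iff.1 hmin v hv1).not_gt (lt_of_lt_of_le hv hv2)
  have hφ : ∀ v r, φ (v, r) = φ (v, 0) + r * φ (0, 1) := fun v r => by
    rw [← smul_eq_mul, ← map_smul, ← map_add]
    simp
  have hα : φ (0, 1) < 0 := by
    have e1 := h1 (x, f x + 1) (by simp)
    have e2 := h2 (x, f x) ⟨hx, mem_Iic.2 le_rfl⟩
    rw [hφ] at e1 e2
    linarith
  have hle : ∀ v, φ (v, 0) + f v * φ (0, 1) ≤ u := by
    intro v
    refine le_of_forall_pos_le_add fun ε hε => ?_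
    have := h1 (v, f v + ε / -φ (0, 1)) (by
      show f v < f v + _
      have : 0 < ε / -φ (0, 1) := div_pos hε (by linarith)
      linarith)
    rw [hφ, add_mul, div_neg, neg_mul, div_mul_cancel₀ _ hα.ne] at this
    linarith
  have hge : ∀ v ∈ K, u ≤ φ (v, 0) + f x * φ (0, 1) := fun v hv => by
    rw [← hφ]
    exact h2 _ ⟨hv, mem_Iic.2 le_rfl⟩
  have hsub : ∀ v, φ (v - x, 0) = φ (v, 0) - φ (x, 0) := fun v => by
    rw [← map_sub]; simp
  refine ⟨(-φ (0, 1))⁻¹ • (φ.toLinearMap ∘ₗ LinearMap.inl ℝ E ℝ), fun v => ?_, fun v hv => ?_⟩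
  · show f x + (-φ (0, 1))⁻¹ * φ (v - x, 0) ≤ f v
    rw [hsub, ← le_sub_iff_add_le', inv_mul_le_iff₀ (by linarith)]
    linarith [hle v, hge x hx]
  · show 0 ≤ (-φ (0, 1))⁻¹ * φ (v - x, 0)
    rw [hsub]
    have := hle x
    have := hge v hv
    exact mul_nonneg (inv_nonneg.2 (by linarith)) (by linarith)

/-- Lagrange multipliers for the linear constraint `L v = c` in the minimization of a convex
function over a polyhedron; no constraint qualification is needed. -/
theorem exists_lagrange_multiplier {E : Type*} [NormedAddCommGroup E] [NormedSpace ℝ E]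
    [FiniteDimensional ℝ E] {n : ℕ} {f : E → ℝ} (hf : ConvexOn ℝ univ f) {K : Set E}
    (hK : IsPolyhedron K) (L : E →ₗ[ℝ] Fin n → ℝ) (c : Fin n → ℝ) {x : E} (hx : x ∈ K)
    (hLx : L x = c) (hmin : ∀ v ∈ K, L v = c → f x ≤ f v) :
    ∃ lam : Fin n → ℝ, ∀ v ∈ K, lam ⬝ᵥ (L v - c) ≤ f v - f x := by
  have hconv : Convex ℝ (K ∩ L ⁻¹' {c}) :=
    hK.convex.inter ((convex_singleton c).linear_preimage L)
  obtain ⟨e, he, hee⟩ := exists_subgradient hf hconv ⟨hx, hLx⟩ fun v hv => hmin v hv.1 hv.2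
  obtain ⟨N, a, b, rfl⟩ := hK
  let l : Fin n → E →ₗ[ℝ] ℝ := fun r => LinearMap.proj r ∘ₗ L
  -- the equations `L v = c` enter as pairs of opposite inequalities
  obtain ⟨y, hy0, hyc, hy⟩ := exists_multipliers
    (Sum.elim a (Sum.elim l fun r => -l r)) (Sum.elim b (Sum.elim c (-c))) (x := x) (by
      rintro (t | r | r)
      · exact hx t
      · exact (congrFun hLx r).le
      · exact (congrArg Neg.neg (congrFun hLx r)).le) (-e) (fun v hv => by
      have := hee v ⟨fun t => hv (.inl t), funext fun r => le_antisymm (hv (.inr (.inl r)))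
        (neg_le_neg_iff.1 (hv (.inr (.inr r))))⟩
      simpa using this)
  refine ⟨fun r => y (.inr (.inr r)) - y (.inr (.inl r)), fun v hv => ?_⟩
  have h1 : e (v - x) ≤ f v - f x := by linarith [he v]
  refine le_trans ?_ h1
  have h2 : -e (v - x) = ∑ t, y (.inl t) * a t (v - x)
      + ∑ r, (y (.inr (.inl r)) * l r (v - x) - y (.inr (.inr r)) * l r (v - x)) := by
    rw [← LinearMap.neg_apply, hy]
    simp [LinearMap.sum_apply, Finset.sum_add_distrib, sub_eq_add_neg]
  have h3 : ∑ t, y (.inl t) * a t (v - x) ≤ 0 := by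
    refine Finset.sum_nonpos fun t _ => ?_
    by_cases ht : y (.inl t) = 0
    · simp [ht]
    · refine mul_nonpos_of_nonneg_of_nonpos (hy0 _) ?_
      have e1 : a t x = b t := hyc (.inl t) ht
      have e2 := hv t
      rw [map_sub]
      linarith
  have h4 : (fun r => y (.inr (.inr r)) - y (.inr (.inl r))) ⬝ᵥ (L v - c)
      = -∑ r, (y (.inr (.inl r)) * l r (v - x) - y (.inr (.inr r)) * l r (v - x)) := by
    rw [dotProduct, ← Finset.sum_neg_distrib]
    refine Finset.sum_congr rfl fun r _ => ?_
    have : l r (v - x) = (L v - c) r := by simp [l, ← hLx]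
    rw [this]
    ring
  rw [h4]
  linarith

/-- The graph of the normal cone mapping of a polyhedron. The pieces are indexed by sets of
constraints required to be active. -/
theorem IsPolyhedron.normalCone_graph {m : ℕ} {X : Set (Fin m → ℝ)} (hX : IsPolyhedron X) :
    IsPolyhedralUnion {z : (Fin m → ℝ) × (Fin m → ℝ) |
      z.1 ∈ X ∧ ∀ v ∈ X, z.2 ⬝ᵥ (v - z.1) ≤ 0} := by
  obtain ⟨N, a, b, hab⟩ := id hX
  let g : Fin N → Fin m → ℝ := fun t => (dotProductEquiv ℝ (Fin m)).symm (a t)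
  have hg : ∀ t v, a t v = g t ⬝ᵥ v := fun t v => by
    show _ = dotProductEquiv ℝ (Fin m) (g t) v
    simp [g]
  have hP : ∀ I : Finset (Fin N), IsPolyhedron ({z : (Fin m → ℝ) × (Fin m → ℝ) | z.1 ∈ X} ∩
      ({z | ∀ t : I, b t ≤ a t z.1} ∩
        {z | ∃ y : I → ℝ, (∀ t, 0 ≤ y t) ∧ z.2 = ∑ t, y t • g t})) := by
    intro I
    refine (hX.preimage (LinearMap.fst ℝ _ _)).inter (IsPolyhedron.inter ?_
      ((isPolyhedron_cone fun t : I => g t).preimage (LinearMap.snd ℝ (Fin m → ℝ) (Fin m → ℝ))))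
    convert isPolyhedron_setOf_forall_le (fun t : I => -(a t ∘ₗ LinearMap.fst ℝ _ (Fin m → ℝ)))
      (fun t : I => -b t) using 1
    ext z
    simp
  convert isPolyhedralUnion_iUnion hP using 1
  ext ⟨x, ν⟩
  simp only [mem_ofPred_eq, mem_iUnion, mem_inter_iff]
  constructor
  · rintro ⟨hx, hν⟩
    obtain ⟨y, hy0, hyc, hy⟩ := exists_multipliers a b (x := x) (by rw [hab] at hx; exact hx)
      (dotProductEquiv ℝ (Fin m) ν) fun v hv => hν v (by rw [hab]; exact hv)
    classical
    refine ⟨Finset.univ.filter fun t => y t ≠ 0, hx, fun t => ?_, fun t => y t,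
      fun t => hy0 t, ?_⟩
    · exact (hyc t (Finset.mem_filter.1 t.2).2).ge
    · have h1 := congrArg (dotProductEquiv ℝ (Fin m)).symm hy
      rw [LinearEquiv.symm_apply_apply, map_sum] at h1
      simp only [map_smul] at h1
      rw [h1, Finset.sum_coe_sort (Finset.univ.filter fun t => y t ≠ 0) (fun t => y t • g t),
        Finset.sum_filter_of_ne]
      rintro t - ht h0
      exact ht (by rw [h0, zero_smul])
  · rintro ⟨I, hx, hI, y, hy0, rfl⟩
    refine ⟨hx, fun v hv => ?_⟩
    rw [sum_dotProduct]
    refine Finset.sum_nonpos fun t _ => ?_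
    rw [smul_dotProduct, ← hg, smul_eq_mul, map_sub]
    rw [hab] at hv
    exact mul_nonpos_of_nonneg_of_nonpos (hy0 t) (by linarith [hv t, hI t])

/-- The graph of the subdifferential of the sum of `f` and the indicator function of `X`. -/
theorem constrained_subdifferential_graph {m : ℕ} {f : (Fin m → ℝ) → ℝ}
    (hf : ConvexOn ℝ univ f) (hpl : IsPiecewiseLinear (subdifferential f)) {X : Set (Fin m → ℝ)}
    (hX : IsPolyhedron X) :
    IsPolyhedralUnion {z : (Fin m → ℝ) × (Fin m → ℝ) |
      z.1 ∈ X ∧ ∀ v ∈ X, z.2 ⬝ᵥ (v - z.1) ≤ f v - f z.1} := by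
  let V := Fin m → ℝ
  let x : (V × V) × V →ₗ[ℝ] V := LinearMap.fst ℝ _ _ ∘ₗ LinearMap.fst ℝ _ _
  let η : (V × V) × V →ₗ[ℝ] V := LinearMap.snd ℝ _ _ ∘ₗ LinearMap.fst ℝ _ _
  let e : (V × V) × V →ₗ[ℝ] V := LinearMap.snd ℝ _ _
  have hpl' : IsPolyhedralUnion {z : V × V | z.2 ∈ subdifferential f z.1} := hpl
  convert ((hpl'.preimage (LinearMap.prod x e)).inter
    (hX.normalCone_graph.preimage (LinearMap.prod x (η - e)))).exists_snd using 1
  ext ⟨x, η⟩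
  show (x ∈ X ∧ ∀ v ∈ X, η ⬝ᵥ (v - x) ≤ f v - f x) ↔
    ∃ e, (∀ v, f x + e ⬝ᵥ (v - x) ≤ f v) ∧ x ∈ X ∧ ∀ v ∈ X, (η - e) ⬝ᵥ (v - x) ≤ 0
  constructor
  · rintro ⟨hx, h⟩
    have hg : ConvexOn ℝ univ fun v => f v + dotProductEquiv ℝ (Fin m) (-η) v :=
      hf.add (LinearMap.convexOn _ convex_univ)
    obtain ⟨e, he, hee⟩ := exists_subgradient hg hX.convex hx fun v hv => by
      have := h v hv
      rw [dotProduct_sub] at this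
      simp only [mem_ofPred_eq, dotProductEquiv_apply_apply, neg_dotProduct]
      linarith
    obtain ⟨ε, rfl⟩ := (dotProductEquiv ℝ (Fin m)).surjective e
    simp only [dotProductEquiv_apply_apply, neg_dotProduct] at he hee
    refine ⟨ε + η, fun v => ?_, hx, fun v hv => ?_⟩
    · have := he v
      rw [add_dotProduct, dotProduct_sub η]
      linarith
    · have := hee v hv
      rw [sub_add_cancel_right, neg_dotProduct]
      linarith
  · rintro ⟨e, he, hx, hN⟩
    refine ⟨hx, fun v hv => ?_⟩
    have h1 := he v
    have h2 := hN v hv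
    rw [sub_dotProduct] at h2
    linarith

end Convex

/-! ### The variational inequality and its perturbations -/

section VariationalInequality

variable {p q : ℕ} {m : Fin p → ℕ} {d : Fin q → ℕ} {n : ℕ}

/-- The point whose stacked vector is `v`; inverse to `Point.vec`. -/
def Point.ofVec (v : Idx m d n → ℝ) : Point m d n where
  x i a := v (.inl ⟨i, a⟩)
  y j b := v (.inr (.inl ⟨j, b⟩))
  lam r := v (.inr (.inr r))

@[simp] theorem Point.ofVec_vec (w : Point m d n) : Point.ofVec w.vec = w := rfl

@[simp] theorem Point.vec_ofVec (v : Idx m d n → ℝ) : (Point.ofVec v).vec = v := by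
  ext (a | a | a) <;> rfl

theorem Point.vec_injective : Function.Injective (Point.vec : Point m d n → Idx m d n → ℝ) :=
  Function.LeftInverse.injective Point.ofVec_vec

theorem Point.dotProduct_eq (z u : Idx m d n → ℝ) :
    z ⬝ᵥ u = ∑ i, (Point.ofVec z).x i ⬝ᵥ (Point.ofVec u).x i
      + ∑ j, (Point.ofVec z).y j ⬝ᵥ (Point.ofVec u).y j
      + (Point.ofVec z).lam ⬝ᵥ (Point.ofVec u).lam := by
  simp only [dotProduct, Fintype.sum_sum_type, Fintype.sum_sigma, Point.ofVec, add_assoc]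

namespace Problem

variable (S : Problem m d n)

theorem residual_sub (x x' : ∀ i, Fin (m i) → ℝ) (y y' : ∀ j, Fin (d j) → ℝ) :
    S.residual x y - S.residual x' y'
      = ∑ i, S.A i *ᵥ (x i - x' i) + ∑ j, S.B j *ᵥ (y j - y' j) := by
  simp only [residual, mulVec_sub, Finset.sum_sub_distrib]
  abel

theorem dotProduct_J (w v u : Point m d n) :
    (w.vec - v.vec) ⬝ᵥ S.J u = (w.lam - v.lam) ⬝ᵥ S.residual u.x u.y
      - u.lam ⬝ᵥ (S.residual w.x w.y - S.residual v.x v.y) := by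
  have hT : ∀ {k : ℕ} (A : Matrix (Fin n) (Fin k) ℝ) (x : Fin k → ℝ),
      x ⬝ᵥ (-(Aᵀ *ᵥ u.lam)) = -(u.lam ⬝ᵥ A *ᵥ x) := fun A x => by
    rw [dotProduct_neg, dotProduct_mulVec, vecMul_transpose, dotProduct_comm]
  rw [Point.dotProduct_eq, residual_sub, dotProduct_add, dotProduct_sum, dotProduct_sum]
  have h1 : ∀ i, (Point.ofVec (w.vec - v.vec)).x i ⬝ᵥ (Point.ofVec (S.J u)).x i
      = -(u.lam ⬝ᵥ S.A i *ᵥ (w.x i - v.x i)) := fun i => hT _ _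
  have h2 : ∀ j, (Point.ofVec (w.vec - v.vec)).y j ⬝ᵥ (Point.ofVec (S.J u)).y j
      = -(u.lam ⬝ᵥ S.B j *ᵥ (w.y j - v.y j)) := fun j => hT _ _
  simp only [h1, h2, Finset.sum_neg_distrib]
  show _ + (w.lam - v.lam) ⬝ᵥ S.residual u.x u.y = _
  ring

/-- `𝒥` is affine with skew-symmetric linear part. -/
theorem dotProduct_J_comm (w v : Point m d n) :
    (w.vec - v.vec) ⬝ᵥ S.J w = (w.vec - v.vec) ⬝ᵥ S.J v := by
  rw [dotProduct_J, dotProduct_J]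
  simp only [sub_dotProduct, dotProduct_sub]
  rw [dotProduct_comm w.lam, dotProduct_comm v.lam]
  ring

/-- The variational inequality defining the solution set, with `𝒥` perturbed by the constant
vector `ξ` and evaluated at the candidate solution `v`. -/
def SolvesVI (ξ : Idx m d n → ℝ) (v : Point m d n) : Prop :=
  v ∈ S.domain ∧ ∀ w ∈ S.domain,
    0 ≤ S.objective w.x w.y - S.objective v.x v.y + (w.vec - v.vec) ⬝ᵥ (S.J v + ξ)

theorem mem_solutionSet_iff (v : Point m d n) : v ∈ S.solutionSet ↔ S.SolvesVI 0 v := by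
  refine and_congr Iff.rfl (forall₂_congr fun w _ => ?_)
  rw [add_zero, dotProduct_J_comm]

/-- The left-hand side of the perturbed variational inequality is a sum of one term per block. -/
theorem gap_eq (ξ : Idx m d n → ℝ) (w v : Point m d n) :
    S.objective w.x w.y - S.objective v.x v.y + (w.vec - v.vec) ⬝ᵥ (S.J v + ξ) =
      ∑ i, (S.f i (w.x i) - S.f i (v.x i)
        - ((S.A i)ᵀ *ᵥ v.lam - (Point.ofVec ξ).x i) ⬝ᵥ (w.x i - v.x i))
      + ∑ j, (S.g j (w.y j) - S.g j (v.y j)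
        - ((S.B j)ᵀ *ᵥ v.lam - (Point.ofVec ξ).y j) ⬝ᵥ (w.y j - v.y j))
      + (w.lam - v.lam) ⬝ᵥ (S.residual v.x v.y + (Point.ofVec ξ).lam) := by
  rw [Point.dotProduct_eq]
  have h1 : ∀ i, (Point.ofVec (w.vec - v.vec)).x i ⬝ᵥ (Point.ofVec (S.J v + ξ)).x i
      = -(((S.A i)ᵀ *ᵥ v.lam - (Point.ofVec ξ).x i) ⬝ᵥ (w.x i - v.x i)) := fun i => by
    rw [← neg_dotProduct, neg_sub, dotProduct_comm, sub_eq_neg_add ((Point.ofVec ξ).x i)]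
    rfl
  have h2 : ∀ j, (Point.ofVec (w.vec - v.vec)).y j ⬝ᵥ (Point.ofVec (S.J v + ξ)).y j
      = -(((S.B j)ᵀ *ᵥ v.lam - (Point.ofVec ξ).y j) ⬝ᵥ (w.y j - v.y j)) := fun j => by
    rw [← neg_dotProduct, neg_sub, dotProduct_comm, sub_eq_neg_add ((Point.ofVec ξ).y j)]
    rfl
  have h3 : (Point.ofVec (w.vec - v.vec)).lam ⬝ᵥ (Point.ofVec (S.J v + ξ)).lam
      = (w.lam - v.lam) ⬝ᵥ (S.residual v.x v.y + (Point.ofVec ξ).lam) := rfl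
  simp only [h1, h2, h3, objective, Finset.sum_sub_distrib, Finset.sum_neg_distrib]
  ring

/-- The perturbed variational inequality decouples into one inclusion per block. -/
theorem solvesVI_iff (ξ : Idx m d n → ℝ) (v : Point m d n) : S.SolvesVI ξ v ↔
    (∀ i, v.x i ∈ S.X i ∧ ∀ x ∈ S.X i, ((S.A i)ᵀ *ᵥ v.lam - (Point.ofVec ξ).x i) ⬝ᵥ (x - v.x i)
      ≤ S.f i x - S.f i (v.x i)) ∧
    (∀ j, v.y j ∈ S.Y j ∧ ∀ y ∈ S.Y j, ((S.B j)ᵀ *ᵥ v.lam - (Point.ofVec ξ).y j) ⬝ᵥ (y - v.y j)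
      ≤ S.g j y - S.g j (v.y j)) ∧
    S.residual v.x v.y + (Point.ofVec ξ).lam = 0 := by
  constructor
  · rintro ⟨hv, h⟩
    simp only [gap_eq] at h
    refine ⟨fun i => ⟨hv.1 i, fun x hx => ?_⟩, fun j => ⟨hv.2 j, fun y hy => ?_⟩, ?_⟩
    · have := h ⟨Function.update v.x i x, v.y, v.lam⟩ ⟨fun l => by
        rcases eq_or_ne l i with rfl | hl
        · simpa using hx
        · simpa [Function.update_of_ne hl] using hv.1 l, hv.2⟩
      rw [Finset.sum_eq_single i (fun l _ hl => by simp [Function.update_of_ne hl])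
        (fun h => (h (Finset.mem_univ i)).elim)] at this
      simp only [Function.update_self, sub_self, dotProduct_zero, zero_dotProduct,
        Finset.sum_const_zero, add_zero] at this
      linarith
    · have := h ⟨v.x, Function.update v.y j y, v.lam⟩ ⟨hv.1, fun l => by
        rcases eq_or_ne l j with rfl | hl
        · simpa using hy
        · simpa [Function.update_of_ne hl] using hv.2 l⟩
      dsimp only at this
      rw [Finset.sum_eq_single (M := ℝ) (s := (Finset.univ : Finset (Fin q))) j
        (fun l _ hl => by simp [Function.update_of_ne hl])
        (fun h => (h (Finset.mem_univ j)).elim)] at this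
      simp only [Function.update_self, sub_self, dotProduct_zero, zero_dotProduct,
        Finset.sum_const_zero, add_zero, zero_add] at this
      linarith
    · have := h ⟨v.x, v.y, v.lam - (S.residual v.x v.y + (Point.ofVec ξ).lam)⟩ hv
      simp only [sub_self, dotProduct_zero, Finset.sum_const_zero, add_zero, zero_add,
        sub_sub_cancel_left, neg_dotProduct] at this
      refine dotProduct_self_eq_zero.1 (le_antisymm (by linarith) ?_)
      exact Finset.sum_nonneg fun _ _ => mul_self_nonneg _
  · rintro ⟨hx, hy, hr⟩
    refine ⟨⟨fun i => (hx i).1, fun j => (hy j).1⟩, fun w hw => ?_⟩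
    rw [gap_eq, hr, dotProduct_zero, add_zero]
    exact add_nonneg (Finset.sum_nonneg fun i _ => sub_nonneg.2 ((hx i).2 _ (hw.1 i)))
      (Finset.sum_nonneg fun j _ => sub_nonneg.2 ((hy j).2 _ (hw.2 j)))

/-- The linear part of the constraint. -/
def constraintMap : (∀ i, Fin (m i) → ℝ) × (∀ j, Fin (d j) → ℝ) →ₗ[ℝ] Fin n → ℝ :=
  (∑ i, (S.A i).mulVecLin ∘ₗ LinearMap.proj i) ∘ₗ LinearMap.fst ℝ _ _
    + (∑ j, (S.B j).mulVecLin ∘ₗ LinearMap.proj j) ∘ₗ LinearMap.snd ℝ _ _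

theorem constraintMap_apply (x : ∀ i, Fin (m i) → ℝ) (y : ∀ j, Fin (d j) → ℝ) :
    S.constraintMap (x, y) = ∑ i, S.A i *ᵥ x i + ∑ j, S.B j *ᵥ y j := by
  simp [constraintMap]

theorem residual_eq (x : ∀ i, Fin (m i) → ℝ) (y : ∀ j, Fin (d j) → ℝ) :
    S.residual x y = S.constraintMap (x, y) - S.c := by
  rw [constraintMap_apply, residual]

variable {S}

/-- The graph of the solution mapping `ξ ↦ v` of the perturbed variational inequality. -/
theorem Admissible.solvesVI_graph (hS : S.Admissible) :
    IsPolyhedralUnion {z : (Idx m d n → ℝ) × (Idx m d n → ℝ) |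
      S.SolvesVI z.2 (Point.ofVec z.1)} := by
  let V := Idx m d n → ℝ
  let px : ∀ i, V →ₗ[ℝ] Fin (m i) → ℝ := fun i => LinearMap.funLeft ℝ ℝ fun a => .inl ⟨i, a⟩
  let py : ∀ j, V →ₗ[ℝ] Fin (d j) → ℝ :=
    fun j => LinearMap.funLeft ℝ ℝ fun b => .inr (.inl ⟨j, b⟩)
  let pl : V →ₗ[ℝ] Fin n → ℝ := LinearMap.funLeft ℝ ℝ fun r => .inr (.inr r)
  have hx := IsPolyhedralUnion.iInter fun i =>
    (constrained_subdifferential_graph (hS.convex_f i) (hS.piecewise_f i)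
      (hS.polyhedron_X i)).preimage (V := V × V) (LinearMap.prod (px i ∘ₗ LinearMap.fst ℝ _ _)
        ((S.A i)ᵀ.mulVecLin ∘ₗ pl ∘ₗ LinearMap.fst ℝ _ _ - px i ∘ₗ LinearMap.snd ℝ _ _))
  have hy := IsPolyhedralUnion.iInter fun j =>
    (constrained_subdifferential_graph (hS.convex_g j) (hS.piecewise_g j)
      (hS.polyhedron_Y j)).preimage (V := V × V) (LinearMap.prod (py j ∘ₗ LinearMap.fst ℝ _ _)
        ((S.B j)ᵀ.mulVecLin ∘ₗ pl ∘ₗ LinearMap.fst ℝ _ _ - py j ∘ₗ LinearMap.snd ℝ _ _))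
  have hr := ((isPolyhedron_singleton S.c).preimage (V := V × V)
    (S.constraintMap ∘ₗ (LinearMap.prod (LinearMap.pi px) (LinearMap.pi py)) ∘ₗ
      LinearMap.fst ℝ _ _ + pl ∘ₗ LinearMap.snd ℝ _ _)).isPolyhedralUnion
  convert hx.inter (hy.inter hr) using 1
  ext z
  simp only [mem_ofPred_eq, mem_inter_iff, mem_iInter, solvesVI_iff]
  refine and_congr Iff.rfl (and_congr Iff.rfl ?_)
  rw [residual_eq, sub_add_eq_add_sub, sub_eq_zero]
  rfl

theorem convexOn_objective (hS : S.Admissible) :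
    ConvexOn ℝ univ fun u : (∀ i, Fin (m i) → ℝ) × (∀ j, Fin (d j) → ℝ) =>
      S.objective u.1 u.2 := by
  refine ⟨convex_univ, fun u _ v _ a b ha hb hab => ?_⟩
  simp only [objective, smul_eq_mul, mul_add, Finset.mul_sum]
  rw [add_add_add_comm, ← Finset.sum_add_distrib, ← Finset.sum_add_distrib]
  exact add_le_add
    (Finset.sum_le_sum fun i _ => (hS.convex_f i).2 (mem_univ _) (mem_univ _) ha hb hab)
    (Finset.sum_le_sum fun j _ => (hS.convex_g j).2 (mem_univ _) (mem_univ _) ha hb hab)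

/-- A minimizer together with a Lagrange multiplier solves the variational inequality. -/
theorem Admissible.solutionSet_nonempty (hS : S.Admissible) : S.solutionSet.Nonempty := by
  obtain ⟨x, y, ⟨hx, hy, hc⟩, hmin⟩ := hS.solvable
  let E := (∀ i, Fin (m i) → ℝ) × (∀ j, Fin (d j) → ℝ)
  have hK : IsPolyhedron {u : E | (∀ i, u.1 i ∈ S.X i) ∧ ∀ j, u.2 j ∈ S.Y j} := by
    convert (IsPolyhedron.iInter fun i => (hS.polyhedron_X i).preimage (V := E)
      (LinearMap.proj i ∘ₗ LinearMap.fst ℝ _ _)).inter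
      (IsPolyhedron.iInter fun j => (hS.polyhedron_Y j).preimage (V := E)
      (LinearMap.proj j ∘ₗ LinearMap.snd ℝ _ _)) using 1
    ext u
    simp only [mem_ofPred_eq, mem_inter_iff, mem_iInter]
    rfl
  obtain ⟨lam, hlam⟩ := exists_lagrange_multiplier (convexOn_objective hS) hK S.constraintMap S.c
    (x := (x, y)) ⟨hx, hy⟩ (by rw [constraintMap_apply, hc]) fun u hu hLu =>
      hmin u.1 u.2 ⟨hu.1, hu.2, by rw [← constraintMap_apply]; exact hLu⟩
  refine ⟨⟨x, y, lam⟩, (S.mem_solutionSet_iff _).2 ⟨⟨hx, hy⟩, fun w hw => ?_⟩⟩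
  have hr : S.residual x y = 0 := by rw [residual, hc, sub_self]
  have := hlam (w.x, w.y) hw
  rw [add_zero, dotProduct_J, hr, dotProduct_zero, sub_zero, residual_eq]
  linarith

theorem Admissible.isClosed_solutionSet (hS : S.Admissible) :
    IsClosed {v : Idx m d n → ℝ | Point.ofVec v ∈ S.solutionSet} := by
  obtain ⟨N, Q, hQ, h⟩ := hS.solvesVI_graph.preimage (LinearMap.inl ℝ _ _)
  have : {v : Idx m d n → ℝ | Point.ofVec v ∈ S.solutionSet} = ⋃ t, Q t := by
    rw [← h]
    ext v
    exact S.mem_solutionSet_iff _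
  rw [this]
  exact isClosed_iUnion_of_finite fun t => (hQ t).isClosed

end Problem

end VariationalInequality

/-! ### The matrices `Q`, `M`, `G` and `H` -/

section Matrices

theorem mulVec_injective_of_rank_eq {k n : ℕ} {A : Matrix (Fin n) (Fin k) ℝ} (h : A.rank = k) :
    Function.Injective (A *ᵥ ·) := by
  have h1 := A.mulVecLin.finrank_range_add_finrank_ker
  have h2 : Module.finrank ℝ A.mulVecLin.range = k := h
  rw [h2, Module.finrank_fin_fun, Nat.add_eq_left, Submodule.finrank_eq_zero] at h1
  exact LinearMap.ker_eq_bot.1 h1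

theorem sqNorm_nonneg {n : ℕ} (v : Fin n → ℝ) : 0 ≤ sqNorm v := by
  rw [sqNorm, dotProduct]
  exact Finset.sum_nonneg fun _ _ => mul_self_nonneg _

theorem sqNorm_eq_zero {n : ℕ} {v : Fin n → ℝ} : sqNorm v = 0 ↔ v = 0 := dotProduct_self_eq_zero

theorem sqNorm_sum_le {k n : ℕ} (v : Fin k → Fin n → ℝ) :
    sqNorm (∑ i, v i) ≤ k * ∑ i, sqNorm (v i) := by
  simp only [sqNorm, dotProduct]
  rw [Finset.sum_comm, Finset.mul_sum]
  refine Finset.sum_le_sum fun r _ => ?_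
  have := sq_sum_le_card_mul_sum_sq (s := Finset.univ) (f := fun i => v i r)
  simpa [sq] using this

/-- For `σ > k - 1` this bounds `(σ + 1) ∑ ‖vᵢ‖² - ‖∑ vᵢ‖²` below by a positive multiple of
`∑ ‖vᵢ‖²`; it makes the `x`-block (with `σ₁`) and the `y`-block (with `σ₂`) definite. -/
theorem mul_sum_sqNorm_le {k n : ℕ} (σ : ℝ) (v : Fin k → Fin n → ℝ) :
    (σ + 1 - k) * ∑ i, sqNorm (v i) ≤ (σ + 1) * ∑ i, sqNorm (v i) - sqNorm (∑ i, v i) := by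
  have := sqNorm_sum_le v
  linarith

theorem sqNorm_sub_smul {n : ℕ} (a : ℝ) (u v : Fin n → ℝ) :
    sqNorm (v - a • u) = sqNorm v - 2 * a * (u ⬝ᵥ v) + a ^ 2 * sqNorm u := by
  simp only [sqNorm, sub_dotProduct, dotProduct_sub, smul_dotProduct, dotProduct_smul, smul_eq_mul]
  rw [dotProduct_comm v u]
  ring

variable {p q : ℕ} {m : Fin p → ℕ} {d : Fin q → ℕ} {n : ℕ}

namespace Problem

variable (S : Problem m d n) (P : Params)

/-- The image `∑ᵢ Aᵢ xᵢ` of the `x`-part of a stacked vector. -/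
def sumA (z : Idx m d n → ℝ) : Fin n → ℝ := ∑ i, S.A i *ᵥ (Point.ofVec z).x i

/-- The image `∑ⱼ Bⱼ yⱼ` of the `y`-part of a stacked vector. -/
def sumB (z : Idx m d n → ℝ) : Fin n → ℝ := ∑ j, S.B j *ᵥ (Point.ofVec z).y j

/-- `H_x` is `β (σ₁ + 1)` times the block diagonal matrix of the `Aᵢᵀ Aᵢ`, minus `β 𝒜ᵀ 𝒜`. -/
theorem Hx_mulVec (x : (Σ i, Fin (m i)) → ℝ) (i : Fin p) :
    (fun a => (S.Hx P *ᵥ x) ⟨i, a⟩) = (S.A i)ᵀ *ᵥ (P.β • ((P.σ₁ + 1) • S.A i *ᵥ (fun a => x ⟨i, a⟩)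
      - ∑ l, S.A l *ᵥ fun a => x ⟨l, a⟩)) := by
  ext a
  have h : ∀ l, ∑ c, S.Hx P ⟨i, a⟩ ⟨l, c⟩ * x ⟨l, c⟩ =
      P.β * ((if i = l then P.σ₁ else -1) * ((S.A i)ᵀ *ᵥ S.A l *ᵥ fun a => x ⟨l, a⟩) a) := by
    intro l
    rw [mulVec_mulVec, mulVec, dotProduct, Finset.mul_sum, Finset.mul_sum]
    refine Finset.sum_congr rfl fun c _ => ?_
    simp only [Hx, of_apply]
    ring
  have h2 : ∀ l, (if i = l then P.σ₁ else -1) * ((S.A i)ᵀ *ᵥ S.A l *ᵥ fun a => x ⟨l, a⟩) a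
      = (if i = l then (P.σ₁ + 1) * ((S.A i)ᵀ *ᵥ S.A l *ᵥ fun a => x ⟨l, a⟩) a else 0)
        - ((S.A i)ᵀ *ᵥ S.A l *ᵥ fun a => x ⟨l, a⟩) a := by
    intro l
    split_ifs <;> ring
  rw [mulVec, dotProduct, Fintype.sum_sigma]
  simp only [h]
  rw [← Finset.mul_sum]
  simp only [h2]
  rw [Finset.sum_sub_distrib, Finset.sum_ite_eq, if_pos (Finset.mem_univ _)]
  simp only [mulVec_smul, mulVec_sub, Pi.smul_apply, Pi.sub_apply, smul_eq_mul]
  congr 2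
  rw [mulVec_sum, Finset.sum_apply]

theorem rowB_mulVec (y : (Σ j, Fin (d j)) → ℝ) :
    S.rowB *ᵥ y = ∑ j, S.B j *ᵥ fun b => y ⟨j, b⟩ := by
  ext r
  rw [mulVec, dotProduct, Fintype.sum_sigma, Finset.sum_apply]
  rfl

theorem Dy_mulVec (y : (Σ j, Fin (d j)) → ℝ) (j : Fin q) :
    (fun b => (S.Dy P *ᵥ y) ⟨j, b⟩)
      = (S.B j)ᵀ *ᵥ (((P.σ₂ + 1) * P.β) • S.B j *ᵥ fun b => y ⟨j, b⟩) := by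
  ext b
  rw [mulVec, dotProduct, Fintype.sum_sigma, Finset.sum_eq_single j]
  · rw [mulVec_smul, mulVec_mulVec, Pi.smul_apply, mulVec, dotProduct, smul_eq_mul, Finset.mul_sum]
    refine Finset.sum_congr rfl fun c _ => ?_
    simp only [Dy, of_apply, if_true]
    ring
  · intro l _ hl
    exact Finset.sum_eq_zero fun c _ => by simp [Dy, Ne.symm hl]
  · simp

theorem Q_mulVec_x (z : Idx m d n → ℝ) (i : Fin p) : (Point.ofVec (S.Q P *ᵥ z)).x i =
    (S.A i)ᵀ *ᵥ (P.β • ((P.σ₁ + 1) • S.A i *ᵥ (Point.ofVec z).x i - S.sumA z)) := by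
  have h := S.Hx_mulVec P (z ∘ Sum.inl) i
  rw [Q, fromBlocks_mulVec, zero_mulVec, add_zero]
  exact h

theorem Q_mulVec_y (z : Idx m d n → ℝ) (j : Fin q) : (Point.ofVec (S.Q P *ᵥ z)).y j =
    (S.B j)ᵀ *ᵥ (((P.σ₂ + 1) * P.β) • S.B j *ᵥ (Point.ofVec z).y j
      - P.τ • (Point.ofVec z).lam) := by
  have h := S.Dy_mulVec P (z ∘ Sum.inr ∘ Sum.inl) j
  rw [Q, fromBlocks_mulVec, zero_mulVec, zero_mulVec, zero_add, fromBlocks_mulVec, mulVec_sub,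
    sub_eq_add_neg, ← mulVec_neg, ← neg_smul, mulVec_smul _ (-P.τ), smul_mulVec]
  exact congrArg₂ (· + ·) h rfl

theorem Q_mulVec_lam (z : Idx m d n → ℝ) : (Point.ofVec (S.Q P *ᵥ z)).lam =
    -S.sumB z + (1 / P.β) • (Point.ofVec z).lam := by
  have h := S.rowB_mulVec (z ∘ Sum.inr ∘ Sum.inl)
  rw [Q, fromBlocks_mulVec, zero_mulVec, zero_mulVec, zero_add, fromBlocks_mulVec, neg_mulVec,
    smul_mulVec, smul_mulVec, one_mulVec]
  exact congrArg₂ (· + ·) (congrArg Neg.neg h) rfl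

theorem M_mulVec_x (z : Idx m d n → ℝ) : (Point.ofVec (S.M P *ᵥ z)).x = (Point.ofVec z).x := by
  rw [M, fromBlocks_mulVec, zero_mulVec, add_zero, one_mulVec]
  rfl

theorem M_mulVec_y (z : Idx m d n → ℝ) : (Point.ofVec (S.M P *ᵥ z)).y = (Point.ofVec z).y := by
  rw [M, fromBlocks_mulVec, zero_mulVec, zero_mulVec, zero_add, fromBlocks_mulVec, zero_mulVec,
    one_mulVec, one_mulVec, add_zero, add_zero]
  rfl

theorem M_mulVec_lam (z : Idx m d n → ℝ) : (Point.ofVec (S.M P *ᵥ z)).lam =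
    -((P.s * P.β) • S.sumB z) + (P.τ + P.s) • (Point.ofVec z).lam := by
  have h := S.rowB_mulVec (z ∘ Sum.inr ∘ Sum.inl)
  rw [M, fromBlocks_mulVec, zero_mulVec, zero_mulVec, zero_add, fromBlocks_mulVec, smul_mulVec,
    smul_mulVec, one_mulVec, one_mulVec, one_mulVec, ← neg_smul]
  exact congrArg₂ (· + ·) (congrArg (-(P.s * P.β) • ·) h) rfl

/-- The bilinear form of `Q` in terms of the images of the blocks under `Aᵢ` and `Bⱼ`. -/
theorem dotProduct_Q_mulVec (u z : Idx m d n → ℝ) : u ⬝ᵥ (S.Q P *ᵥ z) =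
    P.β * ((P.σ₁ + 1) * ∑ i, (S.A i *ᵥ (Point.ofVec u).x i) ⬝ᵥ (S.A i *ᵥ (Point.ofVec z).x i)
      - S.sumA u ⬝ᵥ S.sumA z)
    + (P.σ₂ + 1) * P.β *
      ∑ j, (S.B j *ᵥ (Point.ofVec u).y j) ⬝ᵥ (S.B j *ᵥ (Point.ofVec z).y j)
    - P.τ * (S.sumB u ⬝ᵥ (Point.ofVec z).lam) - (Point.ofVec u).lam ⬝ᵥ S.sumB z
    + 1 / P.β * ((Point.ofVec u).lam ⬝ᵥ (Point.ofVec z).lam) := by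
  have hT : ∀ {k : ℕ} (A : Matrix (Fin n) (Fin k) ℝ) (x : Fin k → ℝ) (v : Fin n → ℝ),
      x ⬝ᵥ (Aᵀ *ᵥ v) = (A *ᵥ x) ⬝ᵥ v := fun A x v => by
    rw [dotProduct_mulVec, vecMul_transpose]
  simp only [Point.dotProduct_eq, Q_mulVec_x, Q_mulVec_y, Q_mulVec_lam, hT, dotProduct_sub,
    dotProduct_add, dotProduct_smul, dotProduct_neg, smul_eq_mul, Finset.sum_sub_distrib,
    ← Finset.mul_sum, ← sum_dotProduct]
  simp only [sumA, sumB]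
  ring

variable {S P}

theorem isUnit_M (hP : P.Admissible p q) : IsUnit (S.M P) := by
  rw [← mulVec_injective_iff_isUnit]
  have hker : ∀ z, S.M P *ᵥ z = 0 → z = 0 := by
    intro z hz
    have hx := S.M_mulVec_x P z
    have hy := S.M_mulVec_y P z
    have hl := S.M_mulVec_lam P z
    rw [hz] at hx hy hl
    have hB : S.sumB z = 0 := Finset.sum_eq_zero fun j _ => by
      rw [← hy]
      exact mulVec_zero _
    rw [hB, smul_zero, neg_zero, zero_add] at hl
    have hl' : (Point.ofVec z).lam = 0 :=
      (smul_eq_zero.1 hl.symm).resolve_left hP.2.2.2.2.2.ne'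
    have h0 : Point.ofVec z = Point.ofVec 0 := Point.ext hx.symm hy.symm hl'
    rw [← Point.vec_ofVec z, h0, Point.vec_ofVec]
  intro z z' h
  rw [← sub_eq_zero]
  refine hker _ ?_
  rw [mulVec_sub]
  exact sub_eq_zero.2 h

theorem H_mul_M (hP : P.Admissible p q) : S.H P * S.M P = S.Q P :=
  nonsing_inv_mul_cancel_right _ _ ((isUnit_iff_isUnit_det _).1 (isUnit_M hP))

theorem sumB_M (z : Idx m d n → ℝ) : S.sumB (S.M P *ᵥ z) = S.sumB z := by
  rw [sumB, M_mulVec_y, sumB]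

theorem sumA_M (z : Idx m d n → ℝ) : S.sumA (S.M P *ᵥ z) = S.sumA z := by
  rw [sumA, M_mulVec_x, sumA]

/-- The bilinear form of `Mᵀ Q = Mᵀ H M`, which is symmetric. -/
theorem M_mulVec_dotProduct_Q_mulVec (hβ : P.β ≠ 0) (u z : Idx m d n → ℝ) :
    (S.M P *ᵥ u) ⬝ᵥ (S.Q P *ᵥ z) =
    P.β * ((P.σ₁ + 1) * ∑ i, (S.A i *ᵥ (Point.ofVec u).x i) ⬝ᵥ (S.A i *ᵥ (Point.ofVec z).x i)
      - S.sumA u ⬝ᵥ S.sumA z)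
    + (P.σ₂ + 1) * P.β *
      ∑ j, (S.B j *ᵥ (Point.ofVec u).y j) ⬝ᵥ (S.B j *ᵥ (Point.ofVec z).y j)
    + P.s * P.β * (S.sumB u ⬝ᵥ S.sumB z)
    - (P.τ + P.s) * (S.sumB u ⬝ᵥ (Point.ofVec z).lam + (Point.ofVec u).lam ⬝ᵥ S.sumB z)
    + (P.τ + P.s) / P.β * ((Point.ofVec u).lam ⬝ᵥ (Point.ofVec z).lam) := by
  rw [dotProduct_Q_mulVec, sumA_M, sumB_M, M_mulVec_x, M_mulVec_y, M_mulVec_lam]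
  simp only [add_dotProduct, neg_dotProduct, smul_dotProduct, smul_eq_mul]
  field_simp
  ring

theorem eq_zero_of_blocks (hS : S.Admissible) {z : Idx m d n → ℝ}
    (hA : ∑ i, sqNorm (S.A i *ᵥ (Point.ofVec z).x i) ≤ 0)
    (hB : ∑ j, sqNorm (S.B j *ᵥ (Point.ofVec z).y j) ≤ 0)
    (hl : (Point.ofVec z).lam = 0) : z = 0 := by
  have hA' := (Finset.sum_eq_zero_iff_of_nonneg fun i _ => sqNorm_nonneg _).1
    (hA.antisymm (Finset.sum_nonneg fun i _ => sqNorm_nonneg _))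
  have hB' := (Finset.sum_eq_zero_iff_of_nonneg fun i _ => sqNorm_nonneg _).1
    (hB.antisymm (Finset.sum_nonneg fun i _ => sqNorm_nonneg _))
  have h0 : Point.ofVec z = Point.ofVec 0 := by
    refine Point.ext (funext fun i => ?_) (funext fun j => ?_) hl
    · refine mulVec_injective_of_rank_eq (hS.rank_A i) ?_
      exact (sqNorm_eq_zero.1 (hA' i (Finset.mem_univ _))).trans (mulVec_zero _).symm
    · refine mulVec_injective_of_rank_eq (hS.rank_B j) ?_
      exact (sqNorm_eq_zero.1 (hB' j (Finset.mem_univ _))).trans (mulVec_zero _).symm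
  rw [← Point.vec_ofVec z, h0, Point.vec_ofVec]

/-- Completing the square in `λ` leaves the slack `β (1 - τ) ‖ℬ y‖²`. -/
theorem M_dotProduct_Q_pos (hS : S.Admissible) (hP : P.Admissible p q) {z : Idx m d n → ℝ}
    (hz : z ≠ 0) : 0 < (S.M P *ᵥ z) ⬝ᵥ (S.Q P *ᵥ z) := by
  obtain ⟨hβ, hσ₁, hσ₂, hτ, hs, hτs⟩ := hP
  have hA := mul_sum_sqNorm_le P.σ₁ fun i => S.A i *ᵥ (Point.ofVec z).x i
  have hB := mul_sum_sqNorm_le P.σ₂ fun j => S.B j *ᵥ (Point.ofVec z).y j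
  have hA0 := Finset.sum_nonneg fun i (_ : i ∈ Finset.univ) =>
    sqNorm_nonneg (S.A i *ᵥ (Point.ofVec z).x i)
  have hB0 := Finset.sum_nonneg fun j (_ : j ∈ Finset.univ) =>
    sqNorm_nonneg (S.B j *ᵥ (Point.ofVec z).y j)
  have key : (S.M P *ᵥ z) ⬝ᵥ (S.Q P *ᵥ z) =
      P.β * ((P.σ₁ + 1) * ∑ i, sqNorm (S.A i *ᵥ (Point.ofVec z).x i) - sqNorm (S.sumA z))
      + P.β * ((P.σ₂ + 1) * ∑ j, sqNorm (S.B j *ᵥ (Point.ofVec z).y j) - sqNorm (S.sumB z))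
      + P.β * (1 - P.τ) * sqNorm (S.sumB z)
      + (P.τ + P.s) / P.β * sqNorm ((Point.ofVec z).lam - P.β • S.sumB z) := by
    rw [M_mulVec_dotProduct_Q_mulVec hβ.ne', sqNorm_sub_smul, dotProduct_comm (Point.ofVec z).lam]
    simp only [sqNorm]
    field_simp
    ring
  have h1 := mul_le_mul_of_nonneg_left hA hβ.le
  have h2 := mul_le_mul_of_nonneg_left hB hβ.le
  have h3 : 0 ≤ P.β * ((P.σ₁ + 1 - p) * ∑ i, sqNorm (S.A i *ᵥ (Point.ofVec z).x i)) :=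
    mul_nonneg hβ.le (mul_nonneg (by linarith) hA0)
  have h4 : 0 ≤ P.β * ((P.σ₂ + 1 - q) * ∑ j, sqNorm (S.B j *ᵥ (Point.ofVec z).y j)) :=
    mul_nonneg hβ.le (mul_nonneg (by linarith) hB0)
  have h5 : 0 ≤ P.β * (1 - P.τ) * sqNorm (S.sumB z) :=
    mul_nonneg (mul_nonneg hβ.le (by linarith)) (sqNorm_nonneg _)
  have h6 : 0 ≤ (P.τ + P.s) / P.β * sqNorm ((Point.ofVec z).lam - P.β • S.sumB z) :=
    mul_nonneg (div_nonneg hτs.le hβ.le) (sqNorm_nonneg _)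
  change _ ≤ P.β * (_ - sqNorm (S.sumA z)) at h1
  change _ ≤ P.β * (_ - sqNorm (S.sumB z)) at h2
  by_contra! hle
  have e5 : sqNorm (S.sumB z) = 0 :=
    (mul_eq_zero.1 (h5.antisymm' (by linarith))).resolve_left
      (mul_pos hβ (by linarith)).ne'
  have e6 : sqNorm ((Point.ofVec z).lam - P.β • S.sumB z) = 0 :=
    (mul_eq_zero.1 (h6.antisymm' (by linarith))).resolve_left (div_pos hτs hβ).ne'
  rw [sqNorm_eq_zero.1 e5, smul_zero, sub_zero, sqNorm_eq_zero] at e6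
  refine hz (eq_zero_of_blocks hS ?_ ?_ e6)
  · exact (mul_eq_zero.1 ((mul_eq_zero.1 (h3.antisymm' (by linarith))).resolve_left
      hβ.ne')).resolve_left (by linarith) |>.le
  · exact (mul_eq_zero.1 ((mul_eq_zero.1 (h4.antisymm' (by linarith))).resolve_left
      hβ.ne')).resolve_left (by linarith) |>.le

theorem dotProduct_G_mulVec (u z : Idx m d n → ℝ) : u ⬝ᵥ (S.G P *ᵥ z)
    = u ⬝ᵥ (S.Q P *ᵥ z) + z ⬝ᵥ (S.Q P *ᵥ u) - (S.M P *ᵥ u) ⬝ᵥ (S.Q P *ᵥ z) := by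
  rw [G, sub_mulVec, add_mulVec, dotProduct_sub, dotProduct_add, ← mulVec_mulVec,
    dotProduct_mulVec u (S.M P)ᵀ, vecMul_transpose, dotProduct_mulVec u (S.Q P)ᵀ,
    vecMul_transpose, dotProduct_comm (S.Q P *ᵥ u) z]

/-- Completing the square in `λ` leaves the slack `(1 - τ) / β ‖λ‖²`. -/
theorem dotProduct_G_pos (hS : S.Admissible) (hP : P.Admissible p q) {z : Idx m d n → ℝ}
    (hz : z ≠ 0) : 0 < z ⬝ᵥ (S.G P *ᵥ z) := by
  obtain ⟨hβ, hσ₁, hσ₂, hτ, hs, hτs⟩ := hP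
  have hA := mul_sum_sqNorm_le P.σ₁ fun i => S.A i *ᵥ (Point.ofVec z).x i
  have hB := mul_sum_sqNorm_le P.σ₂ fun j => S.B j *ᵥ (Point.ofVec z).y j
  have hA0 := Finset.sum_nonneg fun i (_ : i ∈ Finset.univ) =>
    sqNorm_nonneg (S.A i *ᵥ (Point.ofVec z).x i)
  have hB0 := Finset.sum_nonneg fun j (_ : j ∈ Finset.univ) =>
    sqNorm_nonneg (S.B j *ᵥ (Point.ofVec z).y j)
  have key : z ⬝ᵥ (S.G P *ᵥ z) =
      P.β * ((P.σ₁ + 1) * ∑ i, sqNorm (S.A i *ᵥ (Point.ofVec z).x i) - sqNorm (S.sumA z))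
      + P.β * ((P.σ₂ + 1) * ∑ j, sqNorm (S.B j *ᵥ (Point.ofVec z).y j) - sqNorm (S.sumB z))
      + (1 - P.s) / P.β * sqNorm ((Point.ofVec z).lam - P.β • S.sumB z)
      + (1 - P.τ) / P.β * sqNorm (Point.ofVec z).lam := by
    rw [dotProduct_G_mulVec, M_mulVec_dotProduct_Q_mulVec hβ.ne', dotProduct_Q_mulVec,
      sqNorm_sub_smul,
      dotProduct_comm (Point.ofVec z).lam]
    simp only [sqNorm]
    field_simp
    ring
  have h1 := mul_le_mul_of_nonneg_left hA hβ.le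
  have h2 := mul_le_mul_of_nonneg_left hB hβ.le
  have h3 : 0 ≤ P.β * ((P.σ₁ + 1 - p) * ∑ i, sqNorm (S.A i *ᵥ (Point.ofVec z).x i)) :=
    mul_nonneg hβ.le (mul_nonneg (by linarith) hA0)
  have h4 : 0 ≤ P.β * ((P.σ₂ + 1 - q) * ∑ j, sqNorm (S.B j *ᵥ (Point.ofVec z).y j)) :=
    mul_nonneg hβ.le (mul_nonneg (by linarith) hB0)
  have h5 : 0 ≤ (1 - P.s) / P.β * sqNorm ((Point.ofVec z).lam - P.β • S.sumB z) :=
    mul_nonneg (div_nonneg (by linarith) hβ.le) (sqNorm_nonneg _)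
  have h6 : 0 ≤ (1 - P.τ) / P.β * sqNorm (Point.ofVec z).lam :=
    mul_nonneg (div_nonneg (by linarith) hβ.le) (sqNorm_nonneg _)
  change _ ≤ P.β * (_ - sqNorm (S.sumA z)) at h1
  change _ ≤ P.β * (_ - sqNorm (S.sumB z)) at h2
  by_contra! hle
  have e6 : sqNorm (Point.ofVec z).lam = 0 :=
    (mul_eq_zero.1 (h6.antisymm' (by linarith))).resolve_left
      (div_pos (by linarith) hβ).ne'
  refine hz (eq_zero_of_blocks hS ?_ ?_ (sqNorm_eq_zero.1 e6))
  · exact (mul_eq_zero.1 ((mul_eq_zero.1 (h3.antisymm' (by linarith))).resolve_left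
      hβ.ne')).resolve_left (by linarith) |>.le
  · exact (mul_eq_zero.1 ((mul_eq_zero.1 (h4.antisymm' (by linarith))).resolve_left
      hβ.ne')).resolve_left (by linarith) |>.le

theorem dotProduct_H_mulVec (hP : P.Admissible p q) (u z : Idx m d n → ℝ) :
    u ⬝ᵥ (S.H P *ᵥ (S.M P *ᵥ z)) = u ⬝ᵥ (S.Q P *ᵥ z) := by
  rw [mulVec_mulVec, H_mul_M hP]

theorem exists_eq_M_mulVec (hP : P.Admissible p q) (v : Idx m d n → ℝ) :
    ∃ z, v = S.M P *ᵥ z :=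
  ⟨(S.M P)⁻¹ *ᵥ v, by
    rw [mulVec_mulVec, mul_nonsing_inv _ ((isUnit_iff_isUnit_det _).1 (isUnit_M hP)), one_mulVec]⟩

theorem isHermitian_of_dotProduct_comm {ι : Type*} [Fintype ι] {N : Matrix ι ι ℝ}
    (h : ∀ u v, u ⬝ᵥ (N *ᵥ v) = v ⬝ᵥ (N *ᵥ u)) : N.IsHermitian := by
  classical
  ext i j
  have := h (Pi.single j 1) (Pi.single i 1)
  simpa using this

theorem M_dotProduct_Q_comm (hβ : P.β ≠ 0) (u z : Idx m d n → ℝ) :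
    (S.M P *ᵥ u) ⬝ᵥ (S.Q P *ᵥ z) = (S.M P *ᵥ z) ⬝ᵥ (S.Q P *ᵥ u) := by
  rw [M_mulVec_dotProduct_Q_mulVec hβ, M_mulVec_dotProduct_Q_mulVec hβ]
  simp only [dotProduct_comm (S.A _ *ᵥ (Point.ofVec u).x _),
    dotProduct_comm (S.B _ *ᵥ (Point.ofVec u).y _), dotProduct_comm (S.sumA u),
    dotProduct_comm (S.sumB u), dotProduct_comm (Point.ofVec u).lam]
  ring

theorem posDef_H (hS : S.Admissible) (hP : P.Admissible p q) : (S.H P).PosDef := by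
  refine .of_dotProduct_mulVec_pos (isHermitian_of_dotProduct_comm fun u v => ?_) fun v hv => ?_
  · obtain ⟨u, rfl⟩ := exists_eq_M_mulVec (S := S) hP u
    obtain ⟨v, rfl⟩ := exists_eq_M_mulVec (S := S) hP v
    rw [dotProduct_H_mulVec hP, dotProduct_H_mulVec hP, M_dotProduct_Q_comm hP.1.ne']
  · obtain ⟨z, rfl⟩ := exists_eq_M_mulVec (S := S) hP v
    rw [star_trivial, dotProduct_H_mulVec hP]
    refine M_dotProduct_Q_pos hS hP ?_
    rintro rfl
    exact hv (mulVec_zero _)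

theorem posDef_G (hS : S.Admissible) (hP : P.Admissible p q) : (S.G P).PosDef := by
  refine .of_dotProduct_mulVec_pos (isHermitian_of_dotProduct_comm fun u v => ?_) fun v hv => ?_
  · rw [dotProduct_G_mulVec, dotProduct_G_mulVec, M_dotProduct_Q_comm hP.1.ne',
      add_comm (u ⬝ᵥ _)]
  · rw [star_trivial]
    exact dotProduct_G_pos hS hP hv

end Problem

end Matrices

/-! ### One iteration as a perturbed variational inequality -/

section Iteration

/-- First-order optimality for a convex function plus the quadratic terms of a subproblem. -/
theorem prox_firstOrder {k n : ℕ} {f : (Fin k → ℝ) → ℝ} (hf : ConvexOn ℝ univ f)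
    {X : Set (Fin k → ℝ)} (hX : Convex ℝ X) (A : Matrix (Fin n) (Fin k) ℝ) (r lam : Fin n → ℝ)
    (x₀ : Fin k → ℝ) (K β γ : ℝ) {x : Fin k → ℝ} (hx : x ∈ X)
    (hmin : IsMinOn (fun ξ => f ξ + K - lam ⬝ᵥ (r + A *ᵥ (ξ - x₀))
      + β / 2 * sqNorm (r + A *ᵥ (ξ - x₀)) + γ / 2 * sqNorm (A *ᵥ (ξ - x₀))) X x)
    {v : Fin k → ℝ} (hv : v ∈ X) :
    0 ≤ f v - f x + (A *ᵥ (v - x)) ⬝ᵥ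
      (-lam + β • (r + A *ᵥ (x - x₀)) + γ • A *ᵥ (x - x₀)) := by
  set a := A *ᵥ (v - x) with ha
  set b := A *ᵥ (x - x₀) with hb
  have hline : ∀ t : ℝ, 0 < t → t ≤ 1 → 0 ≤ (f v - f x + a ⬝ᵥ (-lam + β • (r + b) + γ • b))
      + t * ((β + γ) / 2 * sqNorm a) := by
    intro t ht0 ht1
    have hmem : x + t • (v - x) ∈ X := hX.add_smul_sub_mem hx hv ⟨ht0.le, ht1⟩
    have h1 := isMinOn_iff.1 hmin _ hmem
    have h2 : f (x + t • (v - x)) ≤ f x + t * (f v - f x) := by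
      have := hf.2 (mem_univ x) (mem_univ v) (sub_nonneg.2 ht1) ht0.le (by ring)
      have e : (1 - t) • x + t • v = x + t • (v - x) := by module
      rw [e, smul_eq_mul, smul_eq_mul] at this
      linarith
    have h3 : A *ᵥ (x + t • (v - x) - x₀) = b + t • a := by
      rw [ha, hb, ← mulVec_smul, ← mulVec_add]
      congr 1
      module
    rw [h3, ← hb] at h1
    have h4 : r + (b + t • a) = (r + b) - (-t) • a := by module
    have h5 : b + t • a = b - (-t) • a := by module
    rw [h4, h5, sqNorm_sub_smul, sqNorm_sub_smul, dotProduct_sub, dotProduct_smul] at h1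
    simp only [dotProduct_add, dotProduct_neg, dotProduct_smul, smul_eq_mul] at h1 ⊢
    rw [dotProduct_comm lam a] at h1
    have h6 : 0 ≤ t * ((f v - f x + (-(a ⬝ᵥ lam) + β * (a ⬝ᵥ r + a ⬝ᵥ b) + γ * (a ⬝ᵥ b)))
        + t * ((β + γ) / 2 * sqNorm a)) := by
      linarith
    exact nonneg_of_mul_nonneg_right h6 ht0
  have hlim : Tendsto (fun t : ℝ => (f v - f x + a ⬝ᵥ (-lam + β • (r + b) + γ • b))
      + t * ((β + γ) / 2 * sqNorm a)) (𝓝[>] 0)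
      (𝓝 (f v - f x + a ⬝ᵥ (-lam + β • (r + b) + γ • b))) := by
    have : Continuous fun t : ℝ => (f v - f x + a ⬝ᵥ (-lam + β • (r + b) + γ • b))
      + t * ((β + γ) / 2 * sqNorm a) := by fun_prop
    simpa using (this.tendsto 0).mono_left nhdsWithin_le_nhds
  refine ge_of_tendsto hlim ?_
  filter_upwards [Ioc_mem_nhdsGT (zero_lt_one' ℝ)] with t ht
  exact hline t ht.1 ht.2

variable {p q : ℕ} {m : Fin p → ℕ} {d : Fin q → ℕ} {n : ℕ}

namespace Problem

variable (S : Problem m d n) (P : Params)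

/-- The predictor `(xᵏ⁺¹, yᵏ⁺¹, λᵏ - β (𝒜xᵏ⁺¹ + ℬyᵏ - c))` of the iteration from `w = wᵏ` to
`w' = wᵏ⁺¹`. -/
def predictor (w w' : Point m d n) : Point m d n :=
  ⟨w'.x, w'.y, w.lam - P.β • S.residual w'.x w.y⟩

theorem residual_update_x (x : ∀ i, Fin (m i) → ℝ) (y : ∀ j, Fin (d j) → ℝ) (i : Fin p)
    (ξ : Fin (m i) → ℝ) :
    S.residual (Function.update x i ξ) y = S.residual x y + S.A i *ᵥ (ξ - x i) := by
  rw [← sub_eq_iff_eq_add', residual_sub, Finset.sum_eq_single i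
    (fun l _ hl => by rw [Function.update_of_ne hl, sub_self, mulVec_zero])
    (fun h => (h (Finset.mem_univ i)).elim)]
  simp

theorem residual_update_y (x : ∀ i, Fin (m i) → ℝ) (y : ∀ j, Fin (d j) → ℝ) (j : Fin q)
    (ξ : Fin (d j) → ℝ) :
    S.residual x (Function.update y j ξ) = S.residual x y + S.B j *ᵥ (ξ - y j) := by
  rw [← sub_eq_iff_eq_add', residual_sub, Finset.sum_eq_single (s := (Finset.univ : Finset (Fin q)))
    j (fun l _ hl => by rw [Function.update_of_ne hl, sub_self, mulVec_zero])
    (fun h => (h (Finset.mem_univ j)).elim)]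
  simp

theorem objective_update_x (x : ∀ i, Fin (m i) → ℝ) (y : ∀ j, Fin (d j) → ℝ) (i : Fin p)
    (ξ : Fin (m i) → ℝ) :
    S.objective (Function.update x i ξ) y = S.f i ξ + (S.objective x y - S.f i (x i)) := by
  have h : ∑ l, (S.f l (Function.update x i ξ l) - S.f l (x l)) = S.f i ξ - S.f i (x i) := by
    rw [Finset.sum_eq_single i (fun l _ hl => by rw [Function.update_of_ne hl, sub_self])
      (fun h => (h (Finset.mem_univ i)).elim), Function.update_self]
  rw [Finset.sum_sub_distrib] at h
  simp only [objective]
  linarith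

theorem objective_update_y (x : ∀ i, Fin (m i) → ℝ) (y : ∀ j, Fin (d j) → ℝ) (j : Fin q)
    (ξ : Fin (d j) → ℝ) :
    S.objective x (Function.update y j ξ) = S.g j ξ + (S.objective x y - S.g j (y j)) := by
  have h : ∑ l, (S.g l (Function.update y j ξ l) - S.g l (y l)) = S.g j ξ - S.g j (y j) := by
    rw [Finset.sum_eq_single j (fun l _ hl => by rw [Function.update_of_ne hl, sub_self])
      (fun h => (h (Finset.mem_univ j)).elim), Function.update_self]
  rw [Finset.sum_sub_distrib] at h
  simp only [objective]
  linarith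

variable {S P} {w w' : Point m d n}

/-- The predictor solves the variational inequality up to the perturbation `Q (w̃ - w)`. -/
theorem Step.solvesVI (h : S.Step P w w') (hS : S.Admissible) (hP : P.Admissible p q) :
    S.SolvesVI (S.Q P *ᵥ ((S.predictor P w w').vec - w.vec)) (S.predictor P w w') := by
  have hT : ∀ {k : ℕ} (A : Matrix (Fin n) (Fin k) ℝ) (v : Fin n → ℝ) (x : Fin k → ℝ),
      (Aᵀ *ᵥ v) ⬝ᵥ x = (A *ᵥ x) ⬝ᵥ v := fun A v x => by
    rw [dotProduct_comm, dotProduct_mulVec, vecMul_transpose]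
  set δ := (S.predictor P w w').vec - w.vec with hδ
  have hA : S.residual w'.x w.y = S.residual w.x w.y + S.sumA δ := by
    rw [← sub_eq_iff_eq_add', residual_sub]
    simp only [sub_self, mulVec_zero, Finset.sum_const_zero, add_zero]
    rfl
  have hB : S.residual w'.x w'.y = S.residual w'.x w.y + S.sumB δ := by
    rw [← sub_eq_iff_eq_add', residual_sub]
    simp only [sub_self, mulVec_zero, Finset.sum_const_zero, zero_add]
    rfl
  refine (solvesVI_iff _ _ _).2 ⟨fun i => ⟨h.x_mem i, fun x hx => ?_⟩,
    fun j => ⟨h.y_mem j, fun y hy => ?_⟩, ?_⟩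
  · have hmin := h.x_min i
    simp only [augLagrangian, residual_update_x, objective_update_x] at hmin
    have key := prox_firstOrder (hS.convex_f i) (hS.polyhedron_X i).convex _ _ _ _ _ _ _
      (h.x_mem i) hmin hx
    rw [Q_mulVec_x, ← mulVec_sub, hT]
    have e : -((S.predictor P w w').lam - P.β • ((P.σ₁ + 1) • S.A i *ᵥ (Point.ofVec δ).x i
        - S.sumA δ)) = -w.lam + P.β • (S.residual w.x w.y + S.A i *ᵥ (w'.x i - w.x i))
        + (P.σ₁ * P.β) • S.A i *ᵥ (w'.x i - w.x i) := by
      have e1 : (Point.ofVec δ).x i = w'.x i - w.x i := rfl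
      have e2 : (S.predictor P w w').lam = w.lam - P.β • S.residual w'.x w.y := rfl
      rw [e1, e2, hA]
      module
    rw [← e, dotProduct_neg] at key
    change (S.A i *ᵥ (x - w'.x i)) ⬝ᵥ _ ≤ S.f i x - S.f i (w'.x i)
    linarith
  · have hmin := h.y_min j
    simp only [augLagrangian, residual_update_y, objective_update_y] at hmin
    have key := prox_firstOrder (hS.convex_g j) (hS.polyhedron_Y j).convex _ _ _ _ _ _ _
      (h.y_mem j) hmin hy
    rw [Q_mulVec_y, ← mulVec_sub, hT]
    have e : -((S.predictor P w w').lam - (((P.σ₂ + 1) * P.β) • S.B j *ᵥ (Point.ofVec δ).y j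
        - P.τ • (Point.ofVec δ).lam)) = -S.lamHalf P w w'.x
        + P.β • (S.residual w'.x w.y + S.B j *ᵥ (w'.y j - w.y j))
        + (P.σ₂ * P.β) • S.B j *ᵥ (w'.y j - w.y j) := by
      have e1 : (Point.ofVec δ).y j = w'.y j - w.y j := rfl
      have e2 : (S.predictor P w w').lam = w.lam - P.β • S.residual w'.x w.y := rfl
      have e3 : (Point.ofVec δ).lam = (w.lam - P.β • S.residual w'.x w.y) - w.lam := rfl
      rw [e1, e2, e3, lamHalf]
      module
    rw [← e, dotProduct_neg] at key
    change (S.B j *ᵥ (y - w'.y j)) ⬝ᵥ _ ≤ S.g j y - S.g j (w'.y j)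
    linarith
  · rw [Q_mulVec_lam]
    change S.residual w'.x w'.y + (-S.sumB δ
      + (1 / P.β) • ((w.lam - P.β • S.residual w'.x w.y) - w.lam)) = 0
    rw [hB, sub_sub_cancel_left, smul_neg, smul_smul, one_div, inv_mul_cancel₀ hP.1.ne', one_smul]
    abel

/-- The correction step: `w - w' = M (w - w̃)`. -/
theorem Step.sub_eq (h : S.Step P w w') :
    w.vec - w'.vec = S.M P *ᵥ (w.vec - (S.predictor P w w').vec) := by
  set z := w.vec - (S.predictor P w w').vec with hz
  have hB : S.residual w'.x w'.y = S.residual w'.x w.y - S.sumB z := by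
    rw [eq_sub_iff_add_eq', ← eq_sub_iff_add_eq, residual_sub]
    simp only [sub_self, mulVec_zero, Finset.sum_const_zero, zero_add]
    rfl
  have e : Point.ofVec (w.vec - w'.vec) = Point.ofVec (S.M P *ᵥ z) := by
    refine Point.ext ?_ ?_ ?_
    · rw [M_mulVec_x]; rfl
    · rw [M_mulVec_y]; rfl
    · rw [M_mulVec_lam]
      have e1 : (Point.ofVec z).lam = w.lam - (w.lam - P.β • S.residual w'.x w.y) := rfl
      have e2 : (Point.ofVec (w.vec - w'.vec)).lam = w.lam - w'.lam := rfl
      rw [e1, e2, h.lam_eq, lamHalf, hB]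
      module
  rw [← Point.vec_ofVec (w.vec - w'.vec), e, Point.vec_ofVec]

/-- The squared `H`-distance to a solution decreases by at least `‖w - w̃‖²_G`. -/
theorem Step.sq_dist_add_le (h : S.Step P w w') (hS : S.Admissible) (hP : P.Admissible p q)
    {v : Point m d n} (hv : v ∈ S.solutionSet) :
    (w'.vec - v.vec) ⬝ᵥ (S.H P *ᵥ (w'.vec - v.vec))
      + (w.vec - (S.predictor P w w').vec) ⬝ᵥ (S.G P *ᵥ (w.vec - (S.predictor P w w').vec))
      ≤ (w.vec - v.vec) ⬝ᵥ (S.H P *ᵥ (w.vec - v.vec)) := by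
  have hvi := h.solvesVI hS hP
  have h1 := hvi.2 v hv.1
  have h2 := hv.2 _ hvi.1
  have hsub := h.sub_eq
  set u := S.predictor P w w'
  set z := w.vec - u.vec with hz
  set a := w.vec - v.vec with ha
  have e1 : w'.vec - v.vec = a - S.M P *ᵥ z := by rw [← hsub, ha]; abel
  have e2 : u.vec - w.vec = -z := by rw [hz]; abel
  have e3 : v.vec - u.vec = -(a - z) := by rw [hz, ha]; abel
  have e4 : u.vec - v.vec = a - z := by rw [hz, ha]; abel
  rw [e2, e3, mulVec_neg, dotProduct_add, dotProduct_neg, neg_dotProduct, neg_dotProduct] at h1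
  rw [e4] at h2
  have e5 : (S.M P *ᵥ z) ⬝ᵥ (S.H P *ᵥ a) = a ⬝ᵥ (S.Q P *ᵥ z) := by
    obtain ⟨b, hb⟩ := exists_eq_M_mulVec (S := S) hP a
    rw [hb, dotProduct_H_mulVec hP, M_dotProduct_Q_comm hP.1.ne']
  clear_value a z
  rw [e1, dotProduct_G_mulVec, mulVec_sub _ a, dotProduct_sub, sub_dotProduct, sub_dotProduct,
    dotProduct_H_mulVec hP, dotProduct_H_mulVec hP, e5]
  rw [sub_dotProduct a z (S.Q P *ᵥ z)] at h1
  linarith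

end Problem

end Iteration

/-! ### Spectral bounds and the distance to the solution set -/

section Spectral

variable {ι : Type*} [Fintype ι]

theorem lamMax_nonneg [DecidableEq ι] {N : Matrix ι ι ℝ} (hN : N.PosSemidef) : 0 ≤ lamMax N := by
  refine Real.sSup_nonneg fun x hx => ?_
  rw [hN.isHermitian.spectrum_real_eq_range_eigenvalues] at hx
  obtain ⟨i, rfl⟩ := hx
  exact hN.eigenvalues_nonneg i

theorem lamMax_pos [DecidableEq ι] [Nonempty ι] {N : Matrix ι ι ℝ} (hN : N.PosDef) :
    0 < lamMax N := by
  rw [lamMax, hN.isHermitian.spectrum_real_eq_range_eigenvalues]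
  exact (hN.eigenvalues_pos (Classical.arbitrary ι)).trans_le
    (le_csSup (finite_range _).bddAbove (mem_range_self _))

theorem lamMin_pos [DecidableEq ι] [Nonempty ι] {N : Matrix ι ι ℝ} (hN : N.PosDef) :
    0 < lamMin N := by
  rw [lamMin, hN.isHermitian.spectrum_real_eq_range_eigenvalues]
  obtain ⟨i, hi⟩ := (range_nonempty _).csInf_mem (finite_range hN.isHermitian.eigenvalues)
  rw [← hi]
  exact hN.eigenvalues_pos i

open scoped MatrixOrder Matrix.Norms.L2Operator in
/-- The norm `√(vᵀ N v)` of a positive definite matrix `N` is induced by an injective linear map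
into a Euclidean space. -/
theorem exists_linearMap_norm_sq {N : Matrix ι ι ℝ} (hN : N.PosDef) :
    ∃ L : (ι → ℝ) →ₗ[ℝ] EuclideanSpace ℝ ι, Function.Injective L ∧
      ∀ v, v ⬝ᵥ (N *ᵥ v) = ‖L v‖ ^ 2 := by
  classical
  obtain ⟨B, hB⟩ :=
    CStarAlgebra.nonneg_iff_eq_star_mul_self.1 (nonneg_iff_posSemidef.2 hN.posSemidef)
  let L : (ι → ℝ) →ₗ[ℝ] EuclideanSpace ℝ ι :=
    (WithLp.linearEquiv 2 ℝ (ι → ℝ)).symm.toLinearMap ∘ₗ B.mulVecLin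
  have hL : ∀ v, v ⬝ᵥ (N *ᵥ v) = ‖L v‖ ^ 2 := fun v => by
    rw [hB, star_eq_conjTranspose, conjTranspose_eq_transpose_of_trivial, ← mulVec_mulVec,
      dotProduct_mulVec, vecMul_transpose, EuclideanSpace.real_norm_sq_eq]
    exact Finset.sum_congr rfl fun i _ => (sq _).symm
  refine ⟨L, (injective_iff_map_eq_zero L).2 fun v hv => ?_, hL⟩
  by_contra h0
  have := hN.dotProduct_mulVec_pos h0
  rw [star_trivial, hL, hv] at this
  simp at this

theorem exists_norm_le {E F : Type*} [NormedAddCommGroup E] [NormedSpace ℝ E]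
    [FiniteDimensional ℝ E] [NormedAddCommGroup F] [NormedSpace ℝ F] (L : E →ₗ[ℝ] F) :
    ∃ C > 0, ∀ v, ‖L v‖ ≤ C * ‖v‖ :=
  (LinearMap.toContinuousLinearMap L).bound

theorem exists_mul_sq_le {N : Matrix ι ι ℝ} (hN : N.PosDef) :
    ∃ c > 0, ∀ v, c * ‖v‖ ^ 2 ≤ v ⬝ᵥ (N *ᵥ v) := by
  obtain ⟨L, hinj, hL⟩ := exists_linearMap_norm_sq hN
  obtain ⟨K, hK0, hK⟩ := L.exists_antilipschitzWith (LinearMap.ker_eq_bot.2 hinj)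
  have hK0' : (0 : ℝ) < K := hK0
  refine ⟨1 / (K : ℝ) ^ 2, by positivity, fun v => ?_⟩
  have h1 : ‖v‖ ≤ K * ‖L v‖ := by simpa using hK.le_mul_dist v 0
  rw [hL, one_div, inv_mul_le_iff₀ (by positivity), ← mul_pow]
  exact pow_le_pow_left₀ (norm_nonneg _) h1 2

/-- Fejér monotonicity and a geometric decay of the distance to the target set imply R-linear
convergence to a point of that set. -/
theorem exists_limit_of_fejer {E : Type*} [MetricSpace E] [CompleteSpace E] {T : Set E}
    (hT : IsClosed T) (hne : T.Nonempty) {u : ℕ → E}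
    (hu : ∀ k, ∀ t ∈ T, dist (u (k + 1)) t ≤ dist (u k) t) {r D : ℝ} (hr0 : 0 ≤ r) (hr1 : r < 1)
    (hD : ∀ k, Metric.infDist (u k) T ≤ D * r ^ k) :
    ∃ t ∈ T, Tendsto u atTop (𝓝 t) ∧ ∀ k, dist (u k) t ≤ 2 * D / (1 - r) * r ^ k := by
  -- both endpoints of a step are within `dist (u k) t` of any `t ∈ T`
  have hstep : ∀ k, dist (u k) (u (k + 1)) ≤ 2 * D * r ^ k := by
    intro k
    have h : dist (u k) (u (k + 1)) / 2 ≤ Metric.infDist (u k) T := by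
      refine (Metric.le_infDist hne).2 fun t ht => ?_
      have := dist_triangle_right (u k) (u (k + 1)) t
      linarith [hu k t ht]
    linarith [hD k]
  obtain ⟨t, ht⟩ := cauchySeq_tendsto_of_complete (cauchySeq_of_le_geometric r _ hr1 hstep)
  refine ⟨t, ?_, ht, fun k => ?_⟩
  · have h1 : Tendsto (fun k => Metric.infDist (u k) T) atTop (𝓝 (Metric.infDist t T)) :=
      ((Metric.continuous_infDist_pt T).tendsto t).comp ht
    have h2 : Tendsto (fun k => D * r ^ k) atTop (𝓝 0) := by
      simpa using (tendsto_pow_atTop_nhds_zero_of_lt_one hr0 hr1).const_mul D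
    have h3 := le_of_tendsto_of_tendsto' h1 h2 hD
    exact (hT.mem_iff_infDist_zero hne).2 (h3.antisymm Metric.infDist_nonneg)
  · have := dist_le_of_le_geometric_of_tendsto r _ hr1 hstep ht k
    rwa [mul_div_right_comm] at this

end Spectral

namespace Problem

variable {p q : ℕ} {m : Fin p → ℕ} {d : Fin q → ℕ} {n : ℕ} {S : Problem m d n} {P : Params}

/-- The `H`-distance is the distance after an injective linear change of coordinates; the distance
to the solution set becomes the distance to a closed set. -/
theorem exists_isometric_coordinates (hS : S.Admissible) (hP : P.Admissible p q) :
    ∃ L : (Idx m d n → ℝ) →ₗ[ℝ] EuclideanSpace ℝ (Idx m d n),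
      IsClosedEmbedding L ∧
      (∀ v, v ⬝ᵥ (S.H P *ᵥ v) = ‖L v‖ ^ 2) ∧
      (∀ w v, S.distH P w v = dist (L w.vec) (L v.vec)) ∧
      (∀ w, S.distHSol P w = Metric.infDist (L w.vec) (L ∘ Point.vec '' S.solutionSet)) ∧
      IsClosed (L ∘ Point.vec '' S.solutionSet) ∧ (L ∘ Point.vec '' S.solutionSet).Nonempty := by
  obtain ⟨L, hinj, hL⟩ := exists_linearMap_norm_sq (posDef_H hS hP)
  have hemb := L.isClosedEmbedding_of_injective (LinearMap.ker_eq_bot.2 hinj)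
  have hdist : ∀ w v : Point m d n, S.distH P w v = dist (L w.vec) (L v.vec) := fun w v => by
    rw [distH, hL, Real.sqrt_sq (norm_nonneg _), map_sub, dist_eq_norm]
  refine ⟨L, hemb, hL, hdist, fun w => ?_, ?_, hS.solutionSet_nonempty.image _⟩
  · rw [distHSol, Metric.infDist_eq_iInf, ← sInf_image' (f := fun y => dist (L w.vec) y),
      image_image]
    simp only [hdist, Function.comp]
  · rw [image_comp]
    refine hemb.isClosedMap _ ?_
    convert hS.isClosed_solutionSet using 1
    ext v
    constructor
    · rintro ⟨w, hw, rfl⟩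
      exact hw
    · exact fun hv => ⟨_, hv, Point.vec_ofVec v⟩

theorem kappa_pos (hP : P.Admissible p q) : 0 < S.kappa P := by
  have hmu : ∀ i, 0 ≤ S.mu i := fun i => lamMax_nonneg (by
    simpa using posSemidef_conjTranspose_mul_self (S.A i))
  have hnu : ∀ j, 0 ≤ S.nu j := fun j => lamMax_nonneg (by
    simpa using posSemidef_conjTranspose_mul_self (S.B j))
  have hmu' := Finset.sum_nonneg fun i (_ : i ∈ Finset.univ) => hmu i
  have hnu' := Finset.sum_nonneg fun j (_ : j ∈ Finset.univ) => hnu j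
  have hβ := hP.1
  have : 0 < S.etaBar P := by
    rw [etaBar]
    positivity
  exact this.trans_le ((le_max_right _ _).trans (le_max_right _ _))

theorem eps_eq (ζ : ℝ) :
    S.eps P ζ = lamMin (S.G P) / (S.kappa P * lamMax (S.H P)) / ζ ^ 2 := by
  rw [eps, div_div]
  congr 1
  ring

theorem eps_factor_pos (hn : 1 ≤ n) (hS : S.Admissible) (hP : P.Admissible p q) :
    0 < lamMin (S.G P) / (S.kappa P * lamMax (S.H P)) := by
  have : Nonempty (Fin n) := ⟨⟨0, hn⟩⟩
  exact div_pos (lamMin_pos (posDef_G hS hP))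
    (mul_pos (kappa_pos hP) (lamMax_pos (posDef_H hS hP)))

theorem rate_mem {ζ : ℝ} (h : 0 < S.eps P ζ) : S.rate P ζ ∈ Ioo (0 : ℝ) 1 := by
  have h1 : 1 < √(1 + S.eps P ζ) := Real.lt_sqrt_of_sq_lt (by linarith)
  exact ⟨one_div_pos.2 (by linarith), (div_lt_one (by linarith)).2 h1⟩

theorem rate_sq {ζ : ℝ} (h : 0 < S.eps P ζ) : S.rate P ζ ^ 2 = 1 / (1 + S.eps P ζ) := by
  rw [rate, div_pow, one_pow, Real.sq_sqrt (by linarith)]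

theorem distHSol_pos (hS : S.Admissible) (hP : P.Admissible p q) {w : Point m d n}
    (hw : w ∉ S.solutionSet) : 0 < S.distHSol P w := by
  obtain ⟨L, hemb, -, -, hsol, hcl, hne⟩ := exists_isometric_coordinates hS hP
  rw [hsol]
  refine (hcl.notMem_iff_infDist_pos hne).1 ?_
  rintro ⟨v, hv, hvw⟩
  rw [Point.vec_injective (hemb.injective hvw)] at hv
  exact hw hv

/-! ### Contraction and R-linear convergence -/

/-- Contraction of the distances to the solution set implies R-linear convergence. -/
theorem convergesRLinearly_of_contracts (hS : S.Admissible) (hP : P.Admissible p q) {ζ : ℝ}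
    (hε : 0 < S.eps P ζ) {w : ℕ → Point m d n} (hw : S.IsGSADMM P w) (hc : S.Contracts P ζ w) :
    S.ConvergesRLinearly P ζ w := by
  obtain ⟨L, hemb, hL, hdist, hsol, hcl, hne⟩ := exists_isometric_coordinates hS hP
  obtain ⟨hr0, hr1⟩ := rate_mem hε
  have hfejer : ∀ k, ∀ t ∈ L ∘ Point.vec '' S.solutionSet,
      dist (L (w (k + 1)).vec) t ≤ dist (L (w k).vec) t := by
    rintro k _ ⟨v, hv, rfl⟩
    have h1 := (hw k).sq_dist_add_le hS hP hv
    have h2 := (posDef_G hS hP).posSemidef.dotProduct_mulVec_nonneg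
      ((w k).vec - (S.predictor P (w k) (w (k + 1))).vec)
    rw [star_trivial] at h2
    rw [hL, hL, map_sub, map_sub, ← dist_eq_norm, ← dist_eq_norm] at h1
    exact le_of_sq_le_sq (by simp only [Function.comp]; linarith) dist_nonneg
  have hnonneg : ∀ k, 0 ≤ S.distHSol P (w k) := fun k => by
    rw [hsol]; exact Metric.infDist_nonneg
  have hgeom : ∀ k, S.distHSol P (w k) ≤ S.distHSol P (w 0) * S.rate P ζ ^ k := by
    intro k
    induction k with
    | zero => simp
    | succ k ih =>
      have h1 := hc k
      rw [← rate_sq hε, ← mul_pow] at h1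
      calc _ ≤ S.rate P ζ * S.distHSol P (w k) :=
            le_of_sq_le_sq h1 (mul_nonneg hr0.le (hnonneg k))
        _ ≤ S.rate P ζ * (S.distHSol P (w 0) * S.rate P ζ ^ k) := by gcongr
        _ = _ := by ring
  obtain ⟨_, ⟨v, hv, rfl⟩, ht, hd⟩ := exists_limit_of_fejer hcl hne
    (u := fun k => L (w k).vec) (D := S.distHSol P (w 0)) hfejer hr0.le hr1
    fun k => (hsol (w k)).symm.trans_le (hgeom k)
  have ht' : Tendsto (fun k => (w k).vec) atTop (𝓝 v.vec) :=
    hemb.isEmbedding.tendsto_nhds_iff.2 ht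
  refine ⟨v, hv, ht', fun k => ?_⟩
  rw [hdist, bigC]
  exact hd k

/-- One iteration contracts the squared distance to the solution set by a fixed factor, uniformly
over starting points at bounded distance from the solution set. -/
theorem exists_contraction (hS : S.Admissible) (hP : P.Admissible p q) (R : ℝ) :
    ∃ ε > 0, ∀ w w' : Point m d n, S.Step P w w' → S.distHSol P w ≤ R →
      S.distHSol P w' ^ 2 ≤ 1 / (1 + ε) * S.distHSol P w ^ 2 := by
  obtain ⟨L, hemb, hL, hdist, hsol, hcl, hne⟩ := exists_isometric_coordinates hS hP
  obtain ⟨κ, hκ, ρ, hρ, hlip⟩ := hS.solvesVI_graph.upper_lipschitz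
  obtain ⟨c, hc, hG⟩ := exists_mul_sq_le (posDef_G hS hP)
  obtain ⟨CL, hCL, hCL'⟩ := exists_norm_le L
  obtain ⟨CQ, hCQ, hCQ'⟩ := exists_norm_le (S.Q P).mulVecLin
  obtain ⟨CM, hCM, hCM'⟩ := exists_norm_le (1 - S.M P).mulVecLin
  let K := (CL * (CM + κ * CQ)) ^ 2 + (R * (CQ / ρ)) ^ 2
  have hK : 0 < K := by positivity
  refine ⟨c / K, div_pos hc hK, fun w w' h hR => ?_⟩
  set z := w.vec - (S.predictor P w w').vec with hz
  have hnonneg : ∀ u, 0 ≤ S.distHSol P u := fun u => by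
    rw [hsol]; exact Metric.infDist_nonneg
  have hdec : S.distHSol P w' ^ 2 + c * ‖z‖ ^ 2 ≤ S.distHSol P w ^ 2 := by
    refine Real.sqrt_le_left (hnonneg w) |>.1 ?_
    rw [hsol w]
    refine (Metric.le_infDist hne).2 ?_
    rintro _ ⟨v, hv, rfl⟩
    refine Real.sqrt_le_left dist_nonneg |>.2 ?_
    have h1 := h.sq_dist_add_le hS hP hv
    rw [hL, hL, map_sub, map_sub, ← dist_eq_norm, ← dist_eq_norm] at h1
    have h2 : S.distHSol P w' ^ 2 ≤ dist (L w'.vec) (L v.vec) ^ 2 := by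
      refine pow_le_pow_left₀ (hnonneg w') ?_ 2
      rw [hsol]
      exact Metric.infDist_le_dist_of_mem ⟨v, hv, rfl⟩
    have h3 := hG z
    simp only [Function.comp]
    linarith
  have hbound : S.distHSol P w' ^ 2 ≤ K * ‖z‖ ^ 2 := by
    have hξ : ‖S.Q P *ᵥ ((S.predictor P w w').vec - w.vec)‖ ≤ CQ * ‖z‖ := by
      rw [hz, norm_sub_rev w.vec]
      exact hCQ' _
    rcases lt_or_ge ‖S.Q P *ᵥ ((S.predictor P w w').vec - w.vec)‖ ρ with hlt | hge
    · obtain ⟨v, hv, hvd⟩ := hlip (S.predictor P w w').vec _ (h.solvesVI hS hP) hlt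
      have h1 : S.distHSol P w' ≤ CL * (CM + κ * CQ) * ‖z‖ := by
        have e : w'.vec - v = (1 - S.M P) *ᵥ z + ((S.predictor P w w').vec - v) := by
          rw [sub_mulVec, one_mulVec, ← h.sub_eq, hz]
          abel
        calc S.distHSol P w' ≤ dist (L w'.vec) (L v) := by
              rw [hsol]
              exact Metric.infDist_le_dist_of_mem
                ⟨Point.ofVec v, (S.mem_solutionSet_iff _).2 hv, by simp⟩
          _ ≤ CL * ‖w'.vec - v‖ := by
              rw [dist_eq_norm, ← map_sub]
              exact hCL' _
          _ ≤ CL * (CM * ‖z‖ + κ * (CQ * ‖z‖)) := by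
              rw [e]
              gcongr
              refine (norm_add_le _ _).trans (add_le_add (hCM' z) (hvd.trans ?_))
              exact mul_le_mul_of_nonneg_left hξ hκ.le
          _ = _ := by ring
      calc _ ≤ (CL * (CM + κ * CQ) * ‖z‖) ^ 2 := pow_le_pow_left₀ (hnonneg w') h1 2
        _ = (CL * (CM + κ * CQ)) ^ 2 * ‖z‖ ^ 2 := by ring
        _ ≤ K * ‖z‖ ^ 2 := by
            gcongr
            exact le_add_of_nonneg_right (sq_nonneg _)
    · -- a large perturbation means a large decrease compared with `R`
      have hR0 : 0 ≤ R := (hnonneg w).trans hR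
      have h1 : S.distHSol P w' ≤ R * (CQ / ρ) * ‖z‖ := by
        have h2 : S.distHSol P w' ≤ S.distHSol P w :=
          le_of_sq_le_sq (by nlinarith [sq_nonneg ‖z‖]) (hnonneg w)
        have h3 : 1 ≤ CQ / ρ * ‖z‖ := by
          rw [div_mul_eq_mul_div, le_div_iff₀ hρ, one_mul]
          exact hge.trans hξ
        rw [mul_assoc]
        exact (h2.trans hR).trans (le_mul_of_one_le_right hR0 h3)
      calc _ ≤ (R * (CQ / ρ) * ‖z‖) ^ 2 := pow_le_pow_left₀ (hnonneg w') h1 2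
        _ = (R * (CQ / ρ)) ^ 2 * ‖z‖ ^ 2 := by ring
        _ ≤ K * ‖z‖ ^ 2 := by
            gcongr
            exact le_add_of_nonneg_left (sq_nonneg _)
  have h4 : c / K * S.distHSol P w' ^ 2 ≤ c * ‖z‖ ^ 2 := by
    rw [div_mul_eq_mul_div, div_le_iff₀ hK]
    nlinarith
  rw [div_mul_eq_mul_div, one_mul, le_div_iff₀ (by positivity)]
  linarith

theorem exists_contracts (hn : 1 ≤ n) (hS : S.Admissible) (hP : P.Admissible p q) (R : ℝ) :
    ∃ ζ : ℝ, 0 < ζ ∧ ∀ w : ℕ → Point m d n, S.IsGSADMM P w → S.distHSol P (w 0) ≤ R →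
      S.Contracts P ζ w := by
  obtain ⟨ε, hε, h⟩ := exists_contraction hS hP R
  have hE := eps_factor_pos hn hS hP
  -- `ε(ζ)` is inversely proportional to `ζ²`, so every positive value is attained
  refine ⟨√(lamMin (S.G P) / (S.kappa P * lamMax (S.H P)) / ε), Real.sqrt_pos.2 (div_pos hE hε),
    fun w hw hR => ?_⟩
  have hbdd : ∀ k, S.distHSol P (w k) ≤ R := by
    intro k
    induction k with
    | zero => exact hR
    | succ k ih =>
      refine le_trans ?_ ih
      have h0 : 0 ≤ S.distHSol P (w k) :=
        Real.sInf_nonneg (by rintro _ ⟨v, -, rfl⟩; exact Real.sqrt_nonneg _)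
      refine le_of_sq_le_sq ((h _ _ (hw k) ih).trans ?_) h0
      refine mul_le_of_le_one_left (sq_nonneg _) ((div_le_one (by linarith)).2 (by linarith))
  intro k
  rw [eps_eq, Real.sq_sqrt (div_pos hE hε).le, div_div_cancel₀ hE.ne']
  exact h _ _ (hw k) (hbdd k)

end Problem

end GSADMM

theorem corollary1 {p q n : ℕ} (hp : 1 ≤ p) (hq : 1 ≤ q) (hn : 1 ≤ n)
    (m : Fin p → ℕ) (d : Fin q → ℕ)
    (S : GSADMM.Problem m d n) (hS : S.Admissible)
    (P : GSADMM.Params) (hP : P.Admissible p q) :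
    -- `H` is symmetric positive definite, so that the `H`-distance is a metric
    (S.H P).PosDef ∧
    -- `ε > 0`, `r ∈ (0, 1)`, and `C > 0` unless the starting point is a solution
    (∀ ζ : ℝ, 0 < ζ → 0 < S.eps P ζ ∧ S.rate P ζ ∈ Ioo (0 : ℝ) 1 ∧
      ∀ w₀ : GSADMM.Point m d n, w₀ ∉ S.solutionSet → 0 < S.bigC P ζ w₀) ∧
    -- a constant `ζ` exists, uniformly over starting points at bounded distance from `ℳ*`
    (∀ R : ℝ, ∃ ζ : ℝ, 0 < ζ ∧
      ∀ w : ℕ → GSADMM.Point m d n, S.IsGSADMM P w → S.distHSol P (w 0) ≤ R →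
        S.Contracts P ζ w ∧ S.ConvergesRLinearly P ζ w) ∧
    -- the estimate holds with every constant `ζ` for which the distances contract
    (∀ ζ : ℝ, 0 < ζ →
      ∀ w : ℕ → GSADMM.Point m d n, S.IsGSADMM P w → S.Contracts P ζ w →
        S.ConvergesRLinearly P ζ w) := by
  have hε : ∀ ζ : ℝ, 0 < ζ → 0 < S.eps P ζ := fun ζ hζ => by
    rw [GSADMM.Problem.eps_eq]
    exact div_pos (GSADMM.Problem.eps_factor_pos hn hS hP) (by positivity)
  refine ⟨GSADMM.Problem.posDef_H hS hP, fun ζ hζ => ?_, fun R => ?_, fun ζ hζ w hw hc => ?_⟩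
  · have hr := GSADMM.Problem.rate_mem (hε ζ hζ)
    refine ⟨hε ζ hζ, hr, fun w₀ hw₀ => ?_⟩
    exact div_pos (mul_pos two_pos (GSADMM.Problem.distHSol_pos hS hP hw₀)) (sub_pos.2 hr.2)
  · obtain ⟨ζ, hζ, h⟩ := GSADMM.Problem.exists_contracts hn hS hP R
    exact ⟨ζ, hζ, fun w hw hR => ⟨h w hw hR,
      GSADMM.Problem.convergesRLinearly_of_contracts hS hP (hε ζ hζ) hw (h w hw hR)⟩⟩
  · exact GSADMM.Problem.convergesRLinearly_of_contracts hS hP (hε ζ hζ) hw hc
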